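/- All logarithms have base $2$. Let $\mathcal X,\mathcal Y$ be finite sets, $P_{XY}$ a distribution on $\mathcal X\times\mathcal Y$, and let $(X^n,Y^n)$ be i.i.d. with law $P_{XY}$. For $R_1,R_2\in\mathbb R$ put $$F(R_1,R_2|P_{XY})=\min\Bigl\{D(P_{\tilde U\tilde X\tilde Y}\|P_{\tilde U|\tilde Y}P_{XY})+|I(\tilde U\wedge\tilde Y)-R_2|^+ \;:\; P_{\tilde U\tilde X\tilde Y}\in\mathcal P(\mathcal U\times\mathcal X\times\mathcal Y),\ H(\tilde X|\tilde U)\le R_1,\ |\mathcal U|\le|\mathcal X||\mathcal Y|+2\Bigr\},$$ where $|a|^+=\max\{a,0\}$, and the value is $+\infty$ if no such distribution exists. Let $\mathcal R_{\rm WAK}$ be the set of pairs $(R_1,R_2)$ for which there are finite sets $\mathcal M_1^{(n)},\mathcal M_2^{(n)}$, encoders $\varphi_1^{(n)}:\mathcal X^n\to\mathcal M_1^{(n)}$, $\varphi_2^{(n)}:\mathcal Y^n\to\mathcal M_2^{(n)}$ and decoders $\psi^{(n)}:\mathcal M_1^{(n)}\times\mathcal M_2^{(n)}\to\mathcal X^n$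 with $\limsup_n\frac1n\log|\mathcal M_i^{(n)}|\le R_i$ ($i=1,2$) and $\Pr\bigl(\psi^{(n)}(\varphi_1^{(n)}(X^n),\varphi_2^{(n)}(Y^n))\ne X^n\bigr)\to0$. Let $R_1,R_2\in\mathbb R$, $\delta>0$ and $R_1'=R_1+\delta$. For $n\ge1$ consider finite sets $\mathcal K_n,\mathcal S_n$ with $|\mathcal K_n|\le2^{nR_1}$ and $|\mathcal S_n|\le2^{nR_2}$, a function $g_n:\mathcal Y^n\to\mathcal S_n$, and a random map $F_n:\mathcal X^n\to\mathcal K_n$ (the hash function) that is independent of $(X^n,Y^n)$ and universal, i.e. $\Pr(F_n(x)=F_n(x'))\le1/|\mathcal K_n|$ for all $x\ne x'$ in $\mathcal X^n$. Put $K_n=F_n(X^n)$, $S_n=g_n(Y^n)$ and $$\Delta=d_{\rm var}\bigl(P_{K_nS_nF_n},\,P_{\rm unif}\times P_{S_n}\times P_{F_n}\bigr),\qquad d_{\rm var}(P,Q)=\tfrac12\sum_a|P(a)-Q(a)|,$$ where $P_{\rm unif}$ is the uniform distribution on $\mathcal K_n$. Then: 1. for all such $n,\mathcal K_n,\mathcal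 S_n,g_n,F_n$, $$\Delta\le2^{-nF(R_1',R_2|P_{XY})}+\tfrac12\sqrt{2^{-n\delta}};$$ 2. $F(R_1',R_2|P_{XY})>0$ if and only if $(R_1',R_2)\notin\mathcal R_{\rm WAK}$; 3. hence, if $(R_1',R_2)\notin\mathcal R_{\rm WAK}$, then $\Delta$ decays exponentially: there are $c,C>0$, depending only on $P_{XY},R_1,R_2,\delta$, such that $\Delta\le C\,2^{-cn}$ for all such $n,\mathcal K_n,\mathcal S_n,g_n,F_n$. -/

import Mathlib

open Filter

namespace WAK

noncomputable section

/-! Distributions on a finite set `α` are functions `p : α → ℝ` in `stdSimplex ℝ α`.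
Logarithms and exponentials have base `2`. -/

open Classical in
/-- The law of `h A` when `A` has law `p`. Marginals are instances of it. -/
def push {α β : Type*} [Fintype α] (h : α → β) (p : α → ℝ) : β → ℝ :=
  fun b => ∑ a, if h a = b then p a else 0

open Classical in
/-- The probability of the event `E` under the law `p`. -/
def prob {α : Type*} [Fintype α] (p : α → ℝ) (E : α → Prop) : ℝ :=
  ∑ a, if E a then p a else 0

/-- Total variation distance. -/
def dvar {α : Type*} [Fintype α] (p q : α → ℝ) : ℝ :=
  (1 / 2) * ∑ a, |p a - q a|

/-- Shannon entropy in bits (`0 log 0 = 0`). -/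
def entropy {α : Type*} [Fintype α] (p : α → ℝ) : ℝ :=
  ∑ a, -(p a * Real.logb 2 (p a))

/-- `H(B | A)` for `(A, B)` with joint law `p`. -/
def condEntropy {α β : Type*} [Fintype α] [Fintype β] (p : α × β → ℝ) : ℝ :=
  entropy p - entropy (push Prod.fst p)

/-- `I(A ∧ B)` for `(A, B)` with joint law `p`. -/
def mutualInfo {α β : Type*} [Fintype α] [Fintype β] (p : α × β → ℝ) : ℝ :=
  entropy (push Prod.fst p) + entropy (push Prod.snd p) - entropy p

open Classical in
/-- Kullback-Leibler divergence `D(p ‖ q)` in bits; `+∞` unless `p ≪ q`. -/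
def klBits {α : Type*} [Fintype α] (p q : α → ℝ) : EReal :=
  if ∀ a, q a = 0 → p a = 0 then ((∑ a, p a * Real.logb 2 (p a / q a) : ℝ) : EReal) else ⊤

section Exponent

variable {U X Y : Type*} [Fintype U] [Fintype X] [Fintype Y]

/-- The marginal on `U × Y` of a law on `U × X × Y`. -/
def margUY (p : U × X × Y → ℝ) : U × Y → ℝ := push (fun w => (w.1, w.2.2)) p

/-- The marginal on `U × X` of a law on `U × X × Y`. -/
def margUX (p : U × X × Y → ℝ) : U × X → ℝ := push (fun w => (w.1, w.2.1)) p

/-- The marginal on `Y` of a law on `U × X × Y`. -/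
def margY (p : U × X × Y → ℝ) : Y → ℝ := push (fun w => w.2.2) p

/-- `(u, x, y) ↦ p_{U|Y}(u|y) P(x, y)`. Where `p_Y(y) = 0` the value is `0`; there `p` itself
vanishes, so the divergence of `p` from it does not depend on this convention. -/
def condTimes (p : U × X × Y → ℝ) (P : X × Y → ℝ) : U × X × Y → ℝ :=
  fun w => margUY p (w.1, w.2.2) / margY p w.2.2 * P w.2

/-- `D(p_{UXY} ‖ p_{U|Y} P_{XY}) + |I(U ∧ Y) - R₂|⁺`. -/
def exponentCost (P : X × Y → ℝ) (R₂ : ℝ) (p : U × X × Y → ℝ) : EReal :=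
  klBits p (condTimes p P) + ((max (mutualInfo (margUY p) - R₂) 0 : ℝ) : EReal)

/-- The exponent `F(R₁, R₂ | P)`: the infimum (a minimum, by compactness) of the cost over all laws on `U × X × Y` with
`|U| ≤ |X||Y| + 2` and `H(X | U) ≤ R₁` (`+∞` if there is no such law). -/
def exponentF (P : X × Y → ℝ) (R₁ R₂ : ℝ) : EReal :=
  ⨅ (m : ℕ) (_ : m ≤ Fintype.card X * Fintype.card Y + 2)
    (p : Fin m × X × Y → ℝ) (_ : p ∈ stdSimplex ℝ (Fin m × X × Y))
    (_ : condEntropy (margUX p) ≤ R₁), exponentCost P R₂ p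

end Exponent

/-- `2 ^ (-t)`, with `2 ^ (-∞) = 0`; used for `t ≥ 0` only. -/
def twoPowNeg (t : EReal) : ℝ :=
  if t = ⊤ then 0 else (2 : ℝ) ^ (-t.toReal)

section Source

variable {X Y : Type*} [Fintype X] [Fintype Y]

/-- The law of `(Xⁿ, Yⁿ)` for i.i.d. pairs with law `P`. -/
def iid (P : X × Y → ℝ) (n : ℕ) : (Fin n → X) × (Fin n → Y) → ℝ :=
  fun w => ∏ i, P (w.1 i, w.2 i)

/-- A block code: two separate encoders and a decoder that reproduces `Xⁿ`. -/
structure Code (X Y : Type*) (n : ℕ) where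
  (m₁ m₂ : ℕ)
  enc₁ : (Fin n → X) → Fin m₁
  enc₂ : (Fin n → Y) → Fin m₂
  dec : Fin m₁ × Fin m₂ → (Fin n → X)

/-- The error probability `Pr (X̂ⁿ ≠ Xⁿ)`. -/
def Code.errorProb {n : ℕ} (c : Code X Y n) (P : X × Y → ℝ) : ℝ :=
  prob (iid P n) fun w => c.dec (c.enc₁ w.1, c.enc₂ w.2) ≠ w.1

/-- The achievable rate region `R_WAK` of the source `P`. -/
def achievableRegion (P : X × Y → ℝ) : Set (ℝ × ℝ) :=
  {R | ∃ c : (n : ℕ) → Code X Y n,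
    limsup (fun n : ℕ => ((1 / (n : ℝ) * Real.logb 2 ((c n).m₁ : ℝ) : ℝ) : EReal)) atTop
      ≤ (R.1 : EReal) ∧
    limsup (fun n : ℕ => ((1 / (n : ℝ) * Real.logb 2 ((c n).m₂ : ℝ) : ℝ) : EReal)) atTop
      ≤ (R.2 : EReal) ∧
    Tendsto (fun n => (c n).errorProb P) atTop (nhds 0)}

end Source

section PrivacyAmplification

/-- A random map `F : A → K` with law `Q` is universal: `F(a) = F(a')` with probability at most
`1 / |K|` whenever `a ≠ a'`. -/
def IsUniversalHash {A K : Type*} [Fintype A] [DecidableEq A] [Fintype K]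
    (Q : (A → K) → ℝ) : Prop :=
  ∀ a a' : A, a ≠ a' → prob Q (fun f => f a = f a') ≤ 1 / (Fintype.card K : ℝ)

variable {X Y K S : Type*} [Fintype X] [DecidableEq X] [Fintype Y] [Fintype K] [Fintype S] {n : ℕ}

/-- The joint law of `(K, S, F) = (F(Xⁿ), g(Yⁿ), F)`, where `F` has law `Q` and is independent
of `(Xⁿ, Yⁿ)`. -/
def keyLaw (P : X × Y → ℝ) (g : (Fin n → Y) → S) (Q : ((Fin n → X) → K) → ℝ) :
    K × S × ((Fin n → X) → K) → ℝ :=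
  push (fun w : ((Fin n → X) × (Fin n → Y)) × ((Fin n → X) → K) => (w.2 w.1.1, g w.1.2, w.2))
    (fun w => iid P n w.1 * Q w.2)

/-- The law `P_unif × P_S × P_F` of an ideal key. -/
def idealLaw (P : X × Y → ℝ) (g : (Fin n → Y) → S) (Q : ((Fin n → X) → K) → ℝ) :
    K × S × ((Fin n → X) → K) → ℝ :=
  fun w => 1 / (Fintype.card K : ℝ) * push (fun v => g v.2) (iid P n) w.2.1 * Q w.2.2

/-- The security criterion `Δ = d_var(P_{KSF}, P_unif × P_S × P_F)`. -/
def securityDelta (P : X × Y → ℝ) (g : (Fin n → Y) → S) (Q : ((Fin n → X) → K) → ℝ) : ℝ :=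
  dvar (keyLaw P g Q) (idealLaw P g Q)

end PrivacyAmplification

end

end WAK

/-! Security is reduced to a strong converse. For each value `s` of `g Yⁿ`, call a word `x` heavy if
`P(x | s) > 2^(-n(R₁+δ))`. On the light words the leftover hash lemma, i.e. Cauchy-Schwarz and the
collision bound of a universal family, costs `√(2^(-nδ))`. The heavy words are at most `2^(n(R₁+δ))`
in number, and their total mass is the probability that a list decoder helped by `g Yⁿ` has `Xⁿ` on
its list. `securityDelta_le` combines the two, and `prob_list_decoding_le` bounds that mass by
`2^(-nF)`.

The strong converse is a change of measure. Condition the source on correct list decoding: the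
conditioned law has divergence `-log Pr(success)` from the source, and under it `H(Xⁿ | S)` and
`H(S)` are at most `n` times the rates. With `U = (T, X^{<T}, Y^{<T}, S)` for a uniform time `T`,
the chain rule gives one single-letter law on `U × X × Y` that satisfies the constraint of `F` and
whose cost is at most `-(1/n) log Pr(success)` (`timeSharing_bounds`,
`exists_law_of_list_decoding`). Support reduction in the style of Carathéodory
(`exists_reduced_alphabet`) brings `U` down to `|X||Y| + 2` letters.

The same construction gives one half of the characterization of `F > 0`: a code with error at most
`1/2` yields a law of cost at most `1/n`, and compactness of the set of laws then yields a law of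
cost zero. Conversely, a law of cost zero is a Markov chain `U - Y - X` with `XY`-marginal `P`, `H(X
| U) ≤ R₁` and `I(U ∧ Y) ≤ R₂`; random covering of `Yⁿ` by `U`-words and random binning of `Xⁿ`
(`exists_oneShot_code`), with Chernoff bounds, produce codes. Exponential decay follows at once from
the bound and positivity of `F`. -/

namespace WAK

noncomputable section

/-! ### Image laws and probabilities of events -/

section Push

variable {α β γ : Type*} [Fintype α]

theorem sum_push_mul [Fintype β] (f : α → β) (p : α → ℝ) (φ : β → ℝ) :
    ∑ b, push f p b * φ b = ∑ a, p a * φ (f a) := by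
  classical
  simp only [push, Finset.sum_mul]
  rw [Finset.sum_comm]
  refine Finset.sum_congr rfl fun a _ => ?_
  simp [ite_mul]

theorem sum_push [Fintype β] (f : α → β) (p : α → ℝ) : ∑ b, push f p b = ∑ a, p a := by
  simpa using sum_push_mul f p (fun _ => 1)

theorem push_nonneg (f : α → β) {p : α → ℝ} (hp : ∀ a, 0 ≤ p a) (b : β) : 0 ≤ push f p b := by
  classical
  exact Finset.sum_nonneg fun a _ => by split_ifs <;> simp [hp]

theorem push_mem_stdSimplex [Fintype β] (f : α → β) {p : α → ℝ} (hp : p ∈ stdSimplex ℝ α) :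
    push f p ∈ stdSimplex ℝ β :=
  ⟨push_nonneg f hp.1, (sum_push f p).trans hp.2⟩

theorem push_push [Fintype β] (g : β → γ) (f : α → β) (p : α → ℝ) :
    push g (push f p) = push (g ∘ f) p := by
  classical
  funext c
  have := sum_push_mul f p (fun b => if g b = c then 1 else 0)
  simpa [push] using this

theorem le_push (f : α → β) {p : α → ℝ} (hp : ∀ a, 0 ≤ p a) (a : α) : p a ≤ push f p (f a) := by
  classical
  have := Finset.single_le_sum (f := fun a' => if f a' = f a then p a' else 0)
    (fun a' _ => by split_ifs <;> simp [hp]) (Finset.mem_univ a)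
  simpa [push] using this

theorem push_pos (f : α → β) {p : α → ℝ} (hp : ∀ a, 0 ≤ p a) {a : α} (ha : p a ≠ 0) :
    0 < push f p (f a) :=
  ((hp a).lt_of_ne' ha).trans_le (le_push f hp a)

theorem push_apply_of_injective {f : α → β} (hf : Function.Injective f) (p : α → ℝ) (a : α) :
    push f p (f a) = p a := by
  classical
  simp [push, hf.eq_iff]

theorem push_eq_zero (f : α → β) {p : α → ℝ} {b : β} (h : ∀ a, f a = b → p a = 0) :
    push f p b = 0 := by
  classical
  exact Finset.sum_eq_zero fun a _ => by split_ifs with e <;> simp [h, e]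

theorem exists_of_push_ne_zero {f : α → β} {p : α → ℝ} {b : β} (h : push f p b ≠ 0) :
    ∃ a, f a = b ∧ p a ≠ 0 := by
  by_contra! hc
  exact h (push_eq_zero f hc)

theorem push_fst_apply {β : Type*} [Fintype β] (p : α × β → ℝ) (a : α) :
    push Prod.fst p a = ∑ b, p (a, b) := by
  classical
  simp only [push, Fintype.sum_prod_type]
  rw [Finset.sum_comm]
  simp

theorem push_snd_apply {β : Type*} [Fintype β] (p : α × β → ℝ) (b : β) :
    push Prod.snd p b = ∑ a, p (a, b) := by
  classical
  simp [push, Fintype.sum_prod_type]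

theorem prob_nonneg {p : α → ℝ} (hp : ∀ a, 0 ≤ p a) (E : α → Prop) : 0 ≤ prob p E := by
  classical
  exact Finset.sum_nonneg fun a _ => by split_ifs <;> simp [hp]

theorem prob_mono {p : α → ℝ} (hp : ∀ a, 0 ≤ p a) {E F : α → Prop} (h : ∀ a, E a → F a) :
    prob p E ≤ prob p F := by
  classical
  refine Finset.sum_le_sum fun a _ => ?_
  by_cases hE : E a
  · simp [hE, h a hE]
  · simp only [hE, if_false]; split_ifs <;> simp [hp]

theorem prob_or_le {p : α → ℝ} (hp : ∀ a, 0 ≤ p a) (E F : α → Prop) :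
    prob p (fun a => E a ∨ F a) ≤ prob p E + prob p F := by
  classical
  rw [prob, prob, prob, ← Finset.sum_add_distrib]
  refine Finset.sum_le_sum fun a _ => ?_
  have := hp a
  by_cases hE : E a <;> by_cases hF : F a <;> simp [hE, hF, this]

theorem prob_add_prob_not (p : α → ℝ) (E : α → Prop) :
    prob p E + prob p (fun a => ¬ E a) = ∑ a, p a := by
  classical
  rw [prob, prob, ← Finset.sum_add_distrib]
  refine Finset.sum_congr rfl fun a _ => ?_
  by_cases hE : E a <;> simp [hE]

theorem prob_push [Fintype β] (f : α → β) (p : α → ℝ) (E : β → Prop) :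
    prob (push f p) E = prob p (fun a => E (f a)) := by
  classical
  simpa [prob] using sum_push_mul f p (fun b => if E b then 1 else 0)

theorem continuous_push_apply (f : α → β) (b : β) : Continuous fun p : α → ℝ => push f p b := by
  classical
  refine continuous_finsetSum _ fun a _ => ?_
  split_ifs <;> fun_prop

end Push

/-! ### Gibbs' inequality and its equality case -/

section Gibbs

variable {α : Type*} [Fintype α]

theorem mul_log_div_sub_eq {x y : ℝ} (hy : y ≠ 0) :
    x * Real.log (x / y) - (x - y) = y * InformationTheory.klFun (x / y) := by
  rw [InformationTheory.klFun_apply]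
  field_simp
  ring

theorem sub_le_mul_log_div {x y : ℝ} (hx : 0 ≤ x) (hy : 0 ≤ y) (h : y = 0 → x = 0) :
    x - y ≤ x * Real.log (x / y) := by
  rcases eq_or_ne y 0 with h0 | h0
  · simp [h h0, h0]
  · have := mul_log_div_sub_eq (x := x) h0
    have h2 := mul_nonneg hy (InformationTheory.klFun_nonneg (div_nonneg hx hy))
    linarith

theorem eq_of_mul_log_div_eq {x y : ℝ} (hx : 0 ≤ x) (hy : 0 ≤ y) (h : y = 0 → x = 0)
    (he : x * Real.log (x / y) = x - y) : x = y := by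
  rcases eq_or_ne y 0 with h0 | h0
  · simp [h h0, h0]
  · have := mul_log_div_sub_eq (x := x) h0
    rw [he, sub_self, eq_comm, mul_eq_zero, or_iff_right h0,
      InformationTheory.klFun_eq_zero_iff (div_nonneg hx hy), div_eq_one_iff_eq h0] at this
    exact this

/-- Termwise `x log (x/y) ≥ x - y`, so `q` may have less mass than `p`. This latitude is needed
because the reference measures below lose mass through divisions by zero. -/
theorem sum_mul_log_div_nonneg {p q : α → ℝ} (hp : ∀ a, 0 ≤ p a) (hq : ∀ a, 0 ≤ q a)
    (h : ∀ a, q a = 0 → p a = 0) (hs : ∑ a, q a ≤ ∑ a, p a) :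
    0 ≤ ∑ a, p a * Real.log (p a / q a) := by
  have := Finset.sum_le_sum fun a (_ : a ∈ Finset.univ) =>
    sub_le_mul_log_div (hp a) (hq a) (h a)
  rw [Finset.sum_sub_distrib] at this
  linarith

theorem sum_mul_logb_div {p q : α → ℝ} :
    ∑ a, p a * Real.logb 2 (p a / q a) = (∑ a, p a * Real.log (p a / q a)) / Real.log 2 := by
  rw [Finset.sum_div]
  exact Finset.sum_congr rfl fun a _ => by rw [Real.logb, mul_div_assoc]

theorem sum_mul_logb_div_nonneg {p q : α → ℝ} (hp : ∀ a, 0 ≤ p a) (hq : ∀ a, 0 ≤ q a)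
    (h : ∀ a, q a = 0 → p a = 0) (hs : ∑ a, q a ≤ ∑ a, p a) :
    0 ≤ ∑ a, p a * Real.logb 2 (p a / q a) := by
  rw [sum_mul_logb_div]
  exact div_nonneg (sum_mul_log_div_nonneg hp hq h hs) (Real.log_nonneg (by norm_num))

/-- The termwise inequalities sum to an equality, so each is tight, and `klFun` vanishes only at
`1`. -/
theorem eq_of_sum_mul_logb_div_nonpos {p q : α → ℝ} (hp : ∀ a, 0 ≤ p a) (hq : ∀ a, 0 ≤ q a)
    (h : ∀ a, q a = 0 → p a = 0) (hs : ∑ a, q a ≤ ∑ a, p a)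
    (hle : ∑ a, p a * Real.logb 2 (p a / q a) ≤ 0) : p = q := by
  have hle' : ∑ a, p a * Real.log (p a / q a) ≤ 0 := by
    rw [sum_mul_logb_div] at hle
    by_contra! hc
    exact absurd hle (not_le.2 (div_pos hc (Real.log_pos (by norm_num))))
  have hterm := fun a (_ : a ∈ Finset.univ) => sub_le_mul_log_div (hp a) (hq a) (h a)
  have heq : ∑ a, (p a - q a) = ∑ a, p a * Real.log (p a / q a) := by
    refine le_antisymm (Finset.sum_le_sum hterm) ?_
    rw [Finset.sum_sub_distrib]; linarith
  rw [Finset.sum_eq_sum_iff_of_le hterm] at heq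
  funext a
  exact eq_of_mul_log_div_eq (hp a) (hq a) (h a) (heq a (Finset.mem_univ a)).symm

end Gibbs

/-! ### Shannon entropy of functions of a random variable -/

section Entropy

variable {α β γ δ : Type*} [Fintype α] [Fintype β] [Fintype γ] [Fintype δ]

theorem entropy_push_eq (f : α → β) (p : α → ℝ) :
    entropy (push f p) = ∑ a, p a * -Real.logb 2 (push f p (f a)) := by
  rw [← sum_push_mul f p (fun b => -Real.logb 2 (push f p b))]
  simp [entropy]

/-- The entropy of `f` depends on `f` only through its fibres on the support of the law. -/
theorem entropy_push_congr {p : α → ℝ} {f : α → β} {g : α → γ}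
    (h : ∀ a b, p a ≠ 0 → p b ≠ 0 → (f a = f b ↔ g a = g b)) :
    entropy (push f p) = entropy (push g p) := by
  classical
  rw [entropy_push_eq, entropy_push_eq]
  refine Finset.sum_congr rfl fun a _ => ?_
  by_cases ha : p a = 0
  · simp [ha]
  congr 3
  refine Finset.sum_congr rfl fun b _ => ?_
  by_cases hb : p b = 0
  · simp [hb]
  · simp only [h b a hb ha]

theorem entropy_nonneg {p : α → ℝ} (hp : p ∈ stdSimplex ℝ α) : 0 ≤ entropy p := by
  refine Finset.sum_nonneg fun a _ => ?_
  have h1 : p a ≤ 1 := by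
    rw [← hp.2]; exact Finset.single_le_sum (fun b _ => hp.1 b) (Finset.mem_univ a)
  have := Real.logb_nonpos (b := 2) (by norm_num) (hp.1 a) h1
  nlinarith [hp.1 a]

/-- Strong subadditivity of the Shannon entropy. -/
theorem entropy_submodular {p : α → ℝ} (hp : ∀ a, 0 ≤ p a) (f : α → β) (g : α → γ) (h : α → δ) :
    entropy (push (fun a => (f a, g a, h a)) p) + entropy (push h p) ≤
      entropy (push (fun a => (f a, h a)) p) + entropy (push (fun a => (g a, h a)) p) := by
  classical
  set r := push (fun a => (f a, g a, h a)) p with hr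
  set rf := push (fun a => (f a, h a)) p with hrf
  set rg := push (fun a => (g a, h a)) p with hrg
  set rh := push h p with hrh
  have nr : ∀ w, 0 ≤ r w := push_nonneg _ hp
  have nrf : ∀ w, 0 ≤ rf w := push_nonneg _ hp
  have nrg : ∀ w, 0 ≤ rg w := push_nonneg _ hp
  have nrh : ∀ w, 0 ≤ rh w := push_nonneg _ hp
  -- The law with the same pair marginals that makes `f` and `g` conditionally independent given
  -- `h`; the divergence of `r` from it is the conditional mutual information.
  let q : β × γ × δ → ℝ := fun w => rf (w.1, w.2.2) * rg (w.2.1, w.2.2) / rh w.2.2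
  have hac : ∀ w, q w = 0 → r w = 0 := by
    intro w hw
    by_contra hne
    obtain ⟨a, rfl, ha⟩ := exists_of_push_ne_zero hne
    have h1 := push_pos (fun a => (f a, h a)) hp ha
    have h2 := push_pos (fun a => (g a, h a)) hp ha
    have h3 := push_pos h hp ha
    exact (div_pos (mul_pos h1 h2) h3).ne' hw
  have msum : ∀ d, ∑ b, rf (b, d) = rh d := by
    intro d
    rw [← push_snd_apply, hrf, push_push]; rfl
  have msum' : ∀ d, ∑ b, rg (b, d) = rh d := by
    intro d
    rw [← push_snd_apply, hrg, push_push]; rfl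
  have hs : ∑ w, q w ≤ ∑ w, r w := by
    have : ∑ w, q w = ∑ d, rh d * rh d / rh d := by
      rw [Fintype.sum_prod_type, Finset.sum_congr rfl fun b _ => Fintype.sum_prod_type _]
      simp only [q]
      rw [Finset.sum_congr rfl fun b _ => Finset.sum_comm, Finset.sum_comm]
      refine Finset.sum_congr rfl fun d _ => ?_
      simp only [← Finset.sum_div, ← Finset.mul_sum, msum', ← Finset.sum_mul, msum]
    rw [this, sum_push, ← sum_push h p]
    refine Finset.sum_le_sum fun d _ => ?_
    rcases eq_or_ne (rh d) 0 with h0 | h0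
    · simp [h0, ← hrh]
    · rw [mul_div_assoc, div_self h0, mul_one]
  have key := sum_mul_logb_div_nonneg nr
    (fun w => div_nonneg (mul_nonneg (nrf _) (nrg _)) (nrh _)) hac hs
  rw [hr, sum_push_mul] at key
  rw [entropy_push_eq, entropy_push_eq, entropy_push_eq, entropy_push_eq, ← sub_nonneg,
    ← Finset.sum_add_distrib, ← Finset.sum_add_distrib, ← Finset.sum_sub_distrib]
  refine key.trans_eq (Finset.sum_congr rfl fun a _ => ?_)
  by_cases ha : p a = 0
  · simp [ha]
  have h0 := (push_pos (fun a => (f a, g a, h a)) hp ha).ne'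
  have h1 := (push_pos (fun a => (f a, h a)) hp ha).ne'
  have h2 := (push_pos (fun a => (g a, h a)) hp ha).ne'
  have h3 := (push_pos h hp ha).ne'
  simp only [hrf, hrg, hrh]
  rw [Real.logb_div h0 (div_ne_zero (mul_ne_zero h1 h2) h3), Real.logb_div (mul_ne_zero h1 h2) h3,
    Real.logb_mul h1 h2]
  ring

/-- A fibre of `g` contains the fibre of `f` through the same point, so probabilities grow and
self-information drops. -/
theorem entropy_push_le {p : α → ℝ} (hp : ∀ a, 0 ≤ p a) {f : α → β} {g : α → γ}
    (h : ∀ a b, f a = f b → g a = g b) : entropy (push g p) ≤ entropy (push f p) := by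
  rw [entropy_push_eq, entropy_push_eq]
  refine Finset.sum_le_sum fun a _ => ?_
  by_cases ha : p a = 0
  · simp [ha]
  refine mul_le_mul_of_nonneg_left (neg_le_neg ?_) (hp a)
  refine Real.logb_le_logb_of_le (by norm_num) (push_pos f hp ha) ?_
  classical
  refine Finset.sum_le_sum fun b _ => ?_
  by_cases hb : f b = f a
  · simp [hb, h b a hb]
  · simp only [hb, if_false]; split_ifs <;> simp [hp]

theorem entropy_pair_le {p : α → ℝ} (hp : p ∈ stdSimplex ℝ α) (f : α → β) (g : α → γ) :
    entropy (push (fun a => (f a, g a)) p) ≤ entropy (push f p) + entropy (push g p) := by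
  have h := entropy_submodular hp.1 f g (fun _ => ())
  have e1 : entropy (push (fun a => (f a, g a, ())) p) = entropy (push (fun a => (f a, g a)) p) :=
    entropy_push_congr fun a b _ _ => by simp
  have e2 : entropy (push (fun a => (f a, ())) p) = entropy (push f p) :=
    entropy_push_congr fun a b _ _ => by simp
  have e3 : entropy (push (fun a => (g a, ())) p) = entropy (push g p) :=
    entropy_push_congr fun a b _ _ => by simp
  rw [e1, e2, e3] at h
  have := entropy_nonneg (push_mem_stdSimplex (fun _ => ()) hp)
  linarith

/-- Chain rule: the entropy of a pair whose first component has law `w` and whose second component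
has, given the first, the law of `f a` under `k a`. -/
theorem entropy_mixture {w : α → ℝ} {k : α → β → ℝ} (hk : ∀ a, w a ≠ 0 → ∑ b, k a b = 1)
    (f : α → β → γ) :
    entropy (push (fun v : α × β => (v.1, f v.1 v.2)) (fun v => w v.1 * k v.1 v.2)) =
      entropy w + ∑ a, w a * entropy (push (f a) (k a)) := by
  classical
  have hpush : ∀ a c, push (fun v : α × β => (v.1, f v.1 v.2)) (fun v => w v.1 * k v.1 v.2) (a, c)
      = w a * push (f a) (k a) c := by
    intro a c
    simp only [push, Fintype.sum_prod_type, Prod.mk.injEq, Finset.mul_sum]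
    rw [Finset.sum_eq_single a (by intro b _ hb; simp [hb]) (by simp)]
    simp
  rw [entropy, Fintype.sum_prod_type, entropy, ← Finset.sum_add_distrib]
  refine Finset.sum_congr rfl fun a _ => ?_
  simp only [hpush]
  by_cases ha : w a = 0
  · simp [ha]
  have hs : ∑ c, push (f a) (k a) c = 1 := by rw [sum_push, hk a ha]
  have : ∀ c, -(w a * push (f a) (k a) c * Real.logb 2 (w a * push (f a) (k a) c)) =
      -(w a * Real.logb 2 (w a)) * push (f a) (k a) c +
        w a * -(push (f a) (k a) c * Real.logb 2 (push (f a) (k a) c)) := by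
    intro c
    by_cases hc : push (f a) (k a) c = 0
    · simp [hc]
    · rw [Real.logb_mul ha hc]; ring
  simp only [this, Finset.sum_add_distrib, ← Finset.mul_sum, hs, mul_one, entropy]

/-- If, given `f`, the variable `g` takes at most `c` values, then `H(g | f) ≤ log c`. -/
theorem condEntropy_le_of_card_le {p : α → ℝ} (hp : p ∈ stdSimplex ℝ α) (f : α → β) (g : α → γ)
    {T : β → Finset γ} {c : ℝ} (hT : ∀ a, p a ≠ 0 → g a ∈ T (f a))
    (hc : ∀ b, ((T b).card : ℝ) ≤ (2 : ℝ) ^ c) :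
    entropy (push (fun a => (f a, g a)) p) - entropy (push f p) ≤ c := by
  classical
  set r := push (fun a => (f a, g a)) p with hr
  -- Reference measure for Gibbs: the marginal of `f`, followed by mass `2^(-c)` on each element of
  -- `T`. Its total mass is at most one by the bound on the cardinality.
  let q : β × γ → ℝ := fun w => push f p w.1 * (if w.2 ∈ T w.1 then (2 : ℝ) ^ (-c) else 0)
  have nq : ∀ w, 0 ≤ q w := fun w => mul_nonneg (push_nonneg _ hp.1 _) (by split_ifs <;> positivity)
  have key := sum_mul_logb_div_nonneg (p := r) (q := q) (push_nonneg _ hp.1) nq ?_ ?_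
  · rw [hr, sum_push_mul] at key
    rw [entropy_push_eq, entropy_push_eq, ← sub_nonneg]
    have e : c = ∑ a, p a * c := by rw [← Finset.sum_mul, hp.2, one_mul]
    rw [e, ← Finset.sum_sub_distrib, ← Finset.sum_sub_distrib]
    refine key.trans_eq (Finset.sum_congr rfl fun a _ => ?_)
    by_cases ha : p a = 0
    · simp [ha]
    have h0 := (push_pos (fun a => (f a, g a)) hp.1 ha).ne'
    have h1 := (push_pos f hp.1 ha).ne'
    have h2 : (2 : ℝ) ^ (-c) ≠ 0 := by positivity
    simp only [q, hT a ha, if_true]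
    rw [Real.logb_div h0 (mul_ne_zero h1 h2), Real.logb_mul h1 h2,
      Real.logb_rpow (by norm_num) (by norm_num), ← hr]
    ring
  · intro w hw
    by_contra hne
    obtain ⟨a, rfl, ha⟩ := exists_of_push_ne_zero hne
    have h1 := push_pos f hp.1 ha
    have h2 : (0 : ℝ) < (2 : ℝ) ^ (-c) := by positivity
    simp only [q, hT a ha, if_true] at hw
    exact (mul_pos h1 h2).ne' hw
  · rw [sum_push, ← sum_push f p, Fintype.sum_prod_type]
    refine Finset.sum_le_sum fun b _ => ?_
    simp only [q, ← Finset.mul_sum]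
    refine mul_le_of_le_one_right (push_nonneg _ hp.1 _) ?_
    rw [← Finset.sum_filter, Finset.sum_const, nsmul_eq_mul, Finset.filter_mem_eq_inter,
      Finset.univ_inter]
    calc ((T b).card : ℝ) * (2 : ℝ) ^ (-c) ≤ (2 : ℝ) ^ c * (2 : ℝ) ^ (-c) := by
          gcongr; exact hc b
      _ = 1 := by rw [← Real.rpow_add (by norm_num)]; simp

theorem entropy_le_of_card_le {p : α → ℝ} (hp : p ∈ stdSimplex ℝ α) {c : ℝ}
    (hc : (Fintype.card α : ℝ) ≤ (2 : ℝ) ^ c) : entropy p ≤ c := by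
  have h := condEntropy_le_of_card_le hp (fun _ => ()) id (T := fun _ => Finset.univ) (c := c)
    (by simp) (by simpa using hc)
  have e : entropy (push (fun a => ((), id a)) p) = entropy p := by
    rw [entropy_push_eq, entropy]
    refine Finset.sum_congr rfl fun a _ => ?_
    rw [push_apply_of_injective (fun a b h => by simpa using h)]; ring
  have e2 : entropy (push (fun _ => ()) p) = 0 := by
    rw [entropy_push_eq]
    simp [push, hp.2]
  rw [e, e2] at h
  linarith

theorem continuous_entropy_push (f : α → β) :
    Continuous fun p : α → ℝ => entropy (push f p) := by
  unfold entropy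
  refine continuous_finsetSum _ fun b _ => ?_
  have h : Continuous fun x : ℝ => -(x * Real.logb 2 x) := by
    have : (fun x : ℝ => -(x * Real.logb 2 x)) = fun x => -(x * Real.log x / Real.log 2) := by
      funext x; rw [Real.logb]; ring
    rw [this]
    exact (Real.continuous_mul_log.div_const _).neg
  exact h.comp (continuous_push_apply f b)

end Entropy

/-! ### Support reduction for weights under linear constraints -/

section Sparse

variable {U ι : Type*} [Fintype U] [Fintype ι]

/-- A direction in which the constraints `∑ u, d u * a u i` do not change and the objective does
not increase, supported where `w` is, if `w` has more than `|ι|` atoms. -/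
theorem exists_descent_direction (a : U → ι → ℝ) (c w : U → ℝ)
    (hcard : Fintype.card ι < (Finset.univ.filter fun u => w u ≠ 0).card) :
    ∃ d : U → ℝ, d ≠ 0 ∧ (∀ u, w u = 0 → d u = 0) ∧ (∀ i, ∑ u, d u * a u i = 0) ∧
      ∑ u, d u * c u ≤ 0 := by
  classical
  let s := Finset.univ.filter fun u => w u ≠ 0
  -- There are more atoms than equations, so this map has a nonzero kernel; a kernel vector or its
  -- negative does not increase the objective.
  let L : (s → ℝ) →ₗ[ℝ] (ι → ℝ) := Fintype.linearCombination ℝ (fun u : s => a u)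
  have hker : LinearMap.ker L ≠ ⊥ := by
    apply LinearMap.ker_ne_bot_of_finrank_lt
    simpa using hcard
  obtain ⟨x, hx, hx0⟩ := Submodule.exists_mem_ne_zero_of_ne_bot hker
  let d : U → ℝ := fun u => if h : u ∈ s then x ⟨u, h⟩ else 0
  have hd0 : d ≠ 0 := by
    intro h
    apply hx0
    funext u
    have := congrFun h u
    simpa [d] using this
  have hdw : ∀ u, w u = 0 → d u = 0 := fun u hu => by simp [d, s, hu]
  have hda : ∀ i, ∑ u, d u * a u i = 0 := by
    intro i
    have h1 : ∑ u : s, x u * a u i = 0 := by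
      have := congrFun (LinearMap.mem_ker.1 hx) i
      simpa [L, Fintype.linearCombination_apply, Finset.sum_apply] using this
    rw [← h1, ← Finset.sum_subset (Finset.subset_univ s) (fun u _ hu => by simp [d, hu]),
      ← Finset.sum_coe_sort s]
    exact Finset.sum_congr rfl fun u _ => by simp [d]
  rcases le_total (∑ u, d u * c u) 0 with h | h
  · exact ⟨d, hd0, hdw, hda, h⟩
  · exact ⟨-d, by simpa using hd0, by simpa using hdw, by simpa using hda, by simpa using h⟩

/-- Support reduction: nonnegative weights can be replaced by weights with at most `|ι|` atoms that
satisfy the same `|ι|` linear equations and do not increase a given linear functional. -/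
theorem exists_sparse_weights (a : U → ι → ℝ) (c : U → ℝ) (l : ι → ℝ) (w : U → ℝ)
    (hw : ∀ u, 0 ≤ w u) (h1 : ∀ u, w u ≠ 0 → ∑ i, l i * a u i = 1) :
    ∃ v : U → ℝ, (∀ u, 0 ≤ v u) ∧ (∀ u, w u = 0 → v u = 0) ∧
      (∀ i, ∑ u, v u * a u i = ∑ u, w u * a u i) ∧ ∑ u, v u * c u ≤ ∑ u, w u * c u ∧
      (Finset.univ.filter fun u => v u ≠ 0).card ≤ Fintype.card ι := by
  classical
  induction hN : (Finset.univ.filter fun u => w u ≠ 0).card using Nat.strong_induction_on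
    generalizing w with
  | _ N ih =>
  by_cases hle : N ≤ Fintype.card ι
  · exact ⟨w, hw, fun _ h => h, fun _ => rfl, le_rfl, hN ▸ hle⟩
  obtain ⟨d, hd0, hdw, hda, hdc⟩ := exists_descent_direction a c w (by omega)
  -- On the support, the combination `l` of the constraints is the total mass, so `d` preserves
  -- mass. Hence a nonzero `d` has a negative entry.
  have hdsum : ∑ u, d u = 0 := by
    have : ∑ u, d u = ∑ u, d u * ∑ i, l i * a u i := by
      refine Finset.sum_congr rfl fun u _ => ?_
      by_cases hu : w u = 0
      · simp [hdw u hu]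
      · rw [h1 u hu, mul_one]
    rw [this]
    simp only [Finset.mul_sum]
    rw [Finset.sum_comm]
    refine Finset.sum_eq_zero fun i _ => ?_
    have : ∑ u, d u * (l i * a u i) = l i * ∑ u, d u * a u i := by
      rw [Finset.mul_sum]; exact Finset.sum_congr rfl fun u _ => by ring
    rw [this, hda, mul_zero]
  have hneg : (Finset.univ.filter fun u => d u < 0).Nonempty := by
    by_contra hc
    rw [Finset.not_nonempty_iff_eq_empty, Finset.filter_eq_empty_iff] at hc
    have h0 : ∀ u ∈ Finset.univ, 0 ≤ d u := fun u hu => not_lt.1 (hc hu)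
    rw [Finset.sum_eq_zero_iff_of_nonneg h0] at hdsum
    exact hd0 (funext fun u => hdsum u (Finset.mem_univ u))
  obtain ⟨u₀, hu₀, hmin⟩ := Finset.exists_min_image _ (fun u => w u / -d u) hneg
  have hd₀ : d u₀ < 0 := (Finset.mem_filter.1 hu₀).2
  -- The longest step along `d` that keeps all weights nonnegative; it kills the atom `u₀`.
  set t := w u₀ / -d u₀ with ht
  have ht0 : 0 ≤ t := div_nonneg (hw _) (by linarith)
  let v₁ : U → ℝ := fun u => w u + t * d u
  have hv₁ : ∀ u, 0 ≤ v₁ u := by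
    intro u
    rcases lt_or_ge (d u) 0 with h | h
    · have := hmin u (Finset.mem_filter.2 ⟨Finset.mem_univ u, h⟩)
      rw [le_div_iff₀ (by linarith)] at this
      simp only [v₁]; linarith
    · exact add_nonneg (hw u) (mul_nonneg ht0 h)
  have hv₁w : ∀ u, w u = 0 → v₁ u = 0 := fun u hu => by simp [v₁, hu, hdw u hu]
  have hv₁0 : v₁ u₀ = 0 := by
    have := hd₀.ne
    simp only [v₁, ht]; field_simp; ring
  have hlt : (Finset.univ.filter fun u => v₁ u ≠ 0).card < N := by
    rw [← hN]
    refine Finset.card_lt_card ⟨fun u => ?_, fun h => ?_⟩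
    · simp only [Finset.mem_filter, Finset.mem_univ, true_and]
      exact fun h hu => h (hv₁w u hu)
    · have := @h u₀ (by
        simp only [Finset.mem_filter, Finset.mem_univ, true_and]
        exact fun h' => hd₀.ne (hdw _ h'))
      simp [hv₁0] at this
  have hlin : ∀ φ : U → ℝ, ∑ u, v₁ u * φ u = ∑ u, w u * φ u + t * ∑ u, d u * φ u := by
    intro φ
    rw [Finset.mul_sum, ← Finset.sum_add_distrib]
    exact Finset.sum_congr rfl fun u _ => by simp only [v₁]; ring
  obtain ⟨v, hv, hvv, hva, hvc, hvN⟩ := ih _ hlt v₁ hv₁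
    (fun u hu => h1 u fun h => hu (hv₁w u h)) rfl
  refine ⟨v, hv, fun u hu => hvv u (hv₁w u hu), fun i => ?_, ?_, hvN⟩
  · rw [hva, hlin, hda, mul_zero, add_zero]
  · rw [hlin] at hvc
    nlinarith

end Sparse

/-! ### The cost as a combination of entropies -/

section Cost

variable {U X Y : Type*} [Fintype U] [Fintype X] [Fintype Y]

/-- The value of `D(p_{UXY} ‖ p_{U|Y} P_{XY})` when it is finite. -/
def divReal (P : X × Y → ℝ) (p : U × X × Y → ℝ) : ℝ :=
  entropy (margUY p) - entropy p - entropy (margY p) - ∑ w, p w * Real.logb 2 (P w.2)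

/-- `p_{XY} ≪ P`. -/
def SuppLE (P : X × Y → ℝ) (p : U × X × Y → ℝ) : Prop := ∀ w, P w.2 = 0 → p w = 0

theorem push_id {α : Type*} [Fintype α] (p : α → ℝ) : push (fun a => a) p = p :=
  funext fun a => push_apply_of_injective (f := fun a => a) (fun _ _ h => h) p a

theorem condEntropy_margUX (p : U × X × Y → ℝ) :
    condEntropy (margUX p) =
      entropy (push (fun w => (w.1, w.2.1)) p) - entropy (push Prod.fst p) := by
  rw [condEntropy, margUX, push_push]; rfl

theorem mutualInfo_margUY (p : U × X × Y → ℝ) :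
    mutualInfo (margUY p) =
      entropy (push Prod.fst p) + entropy (margY p) - entropy (margUY p) := by
  rw [mutualInfo, margUY, push_push, push_push]; rfl

theorem mutualInfo_nonneg {p : U × X × Y → ℝ} (hp : p ∈ stdSimplex ℝ (U × X × Y)) :
    0 ≤ mutualInfo (margUY p) := by
  rw [mutualInfo_margUY]
  have := entropy_pair_le hp Prod.fst (fun w => w.2.2)
  simp only [margUY, margY]
  linarith

theorem condEntropy_margUX_nonneg {p : U × X × Y → ℝ} (hp : p ∈ stdSimplex ℝ (U × X × Y)) :
    0 ≤ condEntropy (margUX p) := by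
  rw [condEntropy_margUX, sub_nonneg]
  exact entropy_push_le hp.1 fun a b h => (Prod.mk.injEq _ _ _ _ ▸ h).1

theorem condTimes_ne_zero {P : X × Y → ℝ} {p : U × X × Y → ℝ} (hp : ∀ w, 0 ≤ p w)
    (hs : SuppLE P p) {w : U × X × Y} (hw : p w ≠ 0) :
    0 < margUY p (w.1, w.2.2) ∧ 0 < margY p w.2.2 ∧ P w.2 ≠ 0 :=
  ⟨push_pos (fun w : U × X × Y => (w.1, w.2.2)) hp hw,
    push_pos (fun w : U × X × Y => w.2.2) hp hw, fun h => hw (hs w h)⟩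

theorem condTimes_dom {P : X × Y → ℝ} {p : U × X × Y → ℝ} (hp : ∀ w, 0 ≤ p w)
    (hs : SuppLE P p) (w : U × X × Y) (h : condTimes p P w = 0) : p w = 0 := by
  by_contra hw
  obtain ⟨h1, h2, h3⟩ := condTimes_ne_zero hp hs hw
  exact mul_ne_zero (div_ne_zero h1.ne' h2.ne') h3 h

/-- Expanding the logarithm on the support turns the divergence into entropies plus a term linear in
`p`. This form is continuous and amenable to chain rules. -/
theorem sum_mul_logb_condTimes {P : X × Y → ℝ} {p : U × X × Y → ℝ} (hp : ∀ w, 0 ≤ p w)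
    (hs : SuppLE P p) :
    ∑ w, p w * Real.logb 2 (p w / condTimes p P w) = divReal P p := by
  rw [divReal, margUY, margY, entropy_push_eq, entropy_push_eq, entropy, ← Finset.sum_sub_distrib,
    ← Finset.sum_sub_distrib, ← Finset.sum_sub_distrib]
  refine Finset.sum_congr rfl fun w _ => ?_
  by_cases hw : p w = 0
  · simp [hw]
  obtain ⟨h1, h2, h3⟩ := condTimes_ne_zero hp hs hw
  rw [condTimes, Real.logb_div hw (mul_ne_zero (div_ne_zero h1.ne' h2.ne') h3),
    Real.logb_mul (div_ne_zero h1.ne' h2.ne') h3, Real.logb_div h1.ne' h2.ne']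
  simp only [margUY, margY]
  ring

theorem exponentCost_of_suppLE {P : X × Y → ℝ} {p : U × X × Y → ℝ} (hp : ∀ w, 0 ≤ p w)
    (hs : SuppLE P p) (R₂ : ℝ) :
    exponentCost P R₂ p = ((divReal P p + max (mutualInfo (margUY p) - R₂) 0 : ℝ) : EReal) := by
  rw [exponentCost, klBits, if_pos (condTimes_dom hp hs), sum_mul_logb_condTimes hp hs,
    EReal.coe_add]

theorem suppLE_of_exponentCost_ne_top {P : X × Y → ℝ} {p : U × X × Y → ℝ} {R₂ : ℝ}
    (h : exponentCost P R₂ p ≠ ⊤) : SuppLE P p := by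
  intro w hw
  by_contra hne
  apply h
  rw [exponentCost, klBits, if_neg, EReal.top_add_coe]
  intro hc
  exact hne (hc w (by simp [condTimes, hw]))

theorem condTimes_nonneg {P : X × Y → ℝ} (hP : ∀ z, 0 ≤ P z) {p : U × X × Y → ℝ}
    (hp : ∀ w, 0 ≤ p w) (w : U × X × Y) : 0 ≤ condTimes p P w :=
  mul_nonneg (div_nonneg (push_nonneg _ hp _) (push_nonneg _ hp _)) (hP _)

theorem sum_margUY (p : U × X × Y → ℝ) (y : Y) : ∑ u, margUY p (u, y) = margY p y := by
  rw [← push_snd_apply, margUY, push_push]; rfl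

/-- Only an inequality: the mass of `P` over letters `y` with `p_Y(y) = 0` is lost. -/
theorem sum_condTimes_le {P : X × Y → ℝ} (hP : ∀ z, 0 ≤ P z) (p : U × X × Y → ℝ) :
    ∑ w, condTimes p P w ≤ ∑ z, P z := by
  rw [Fintype.sum_prod_type, Finset.sum_comm]
  refine Finset.sum_le_sum fun z _ => ?_
  simp only [condTimes, ← Finset.sum_mul, ← Finset.sum_div, sum_margUY]
  exact mul_le_of_le_one_left (hP z) (div_self_le_one _)

theorem divReal_nonneg {P : X × Y → ℝ} (hP : P ∈ stdSimplex ℝ (X × Y)) {p : U × X × Y → ℝ}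
    (hp : p ∈ stdSimplex ℝ (U × X × Y)) (hs : SuppLE P p) : 0 ≤ divReal P p := by
  rw [← sum_mul_logb_condTimes hp.1 hs]
  refine sum_mul_logb_div_nonneg hp.1 (condTimes_nonneg hP.1 hp.1) (condTimes_dom hp.1 hs) ?_
  rw [hp.2, ← hP.2]
  exact sum_condTimes_le hP.1 p

/-- Equality case of Gibbs. It is the source of the Markov chain `U - Y - X` used for coding. -/
theorem eq_condTimes_of_divReal_nonpos {P : X × Y → ℝ} (hP : P ∈ stdSimplex ℝ (X × Y))
    {p : U × X × Y → ℝ} (hp : p ∈ stdSimplex ℝ (U × X × Y)) (hs : SuppLE P p)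
    (h : divReal P p ≤ 0) : p = condTimes p P := by
  rw [← sum_mul_logb_condTimes hp.1 hs] at h
  refine eq_of_sum_mul_logb_div_nonpos hp.1 (condTimes_nonneg hP.1 hp.1) (condTimes_dom hp.1 hs)
    ?_ h
  rw [hp.2, ← hP.2]
  exact sum_condTimes_le hP.1 p

theorem exponentCost_nonneg {P : X × Y → ℝ} (hP : P ∈ stdSimplex ℝ (X × Y)) {p : U × X × Y → ℝ}
    (hp : p ∈ stdSimplex ℝ (U × X × Y)) (R₂ : ℝ) : 0 ≤ exponentCost P R₂ p := by
  by_cases h : exponentCost P R₂ p = ⊤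
  · simp [h]
  have hs := suppLE_of_exponentCost_ne_top h
  rw [exponentCost_of_suppLE hp.1 hs]
  exact_mod_cast add_nonneg (divReal_nonneg hP hp hs) (le_max_right _ _)

theorem exponentF_nonneg {P : X × Y → ℝ} (hP : P ∈ stdSimplex ℝ (X × Y)) (R₁ R₂ : ℝ) :
    0 ≤ exponentF P R₁ R₂ :=
  le_iInf fun _ => le_iInf fun _ => le_iInf fun _ => le_iInf fun hp => le_iInf fun _ =>
    exponentCost_nonneg hP hp R₂

end Cost

/-! ### Bounding the alphabet of the auxiliary variable -/

section Reduction

variable {U X Y : Type*} [Fintype U] [Fintype X] [Fintype Y]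

theorem sum_logb_eq (P : X × Y → ℝ) (p : U × X × Y → ℝ) :
    ∑ w, p w * Real.logb 2 (P w.2) = ∑ z, push Prod.snd p z * Real.logb 2 (P z) :=
  (sum_push_mul Prod.snd p fun z => Real.logb 2 (P z)).symm

theorem margY_eq_push_snd (p : U × X × Y → ℝ) : margY p = push Prod.snd (push Prod.snd p) := by
  rw [push_push]; rfl

variable {v : U → ℝ} {k : U → X × Y → ℝ}

theorem push_fst_mixture (hk : ∀ u, v u ≠ 0 → ∑ z, k u z = 1) :
    push Prod.fst (fun w : U × X × Y => v w.1 * k w.1 w.2) = v := by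
  funext u
  rw [push_fst_apply]
  simp only [← Finset.mul_sum]
  by_cases hu : v u = 0
  · simp [hu]
  · rw [hk u hu, mul_one]

/-- For fixed kernels `k`, this quantity is linear in the weights `v`. In the two formulas that
follow, the part not linear in `v` depends only on the `XY`-marginal. Hence linear support reduction
applies. -/
theorem condEntropy_margUX_mixture (hk : ∀ u, v u ≠ 0 → ∑ z, k u z = 1) :
    condEntropy (margUX fun w : U × X × Y => v w.1 * k w.1 w.2) =
      ∑ u, v u * entropy (push Prod.fst (k u)) := by
  rw [condEntropy_margUX, push_fst_mixture hk, entropy_mixture hk (fun _ z => z.1)]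
  exact add_sub_cancel_left _ _

theorem mutualInfo_margUY_mixture (hk : ∀ u, v u ≠ 0 → ∑ z, k u z = 1) :
    mutualInfo (margUY fun w : U × X × Y => v w.1 * k w.1 w.2) =
      entropy (margY fun w : U × X × Y => v w.1 * k w.1 w.2)
        - ∑ u, v u * entropy (push Prod.snd (k u)) := by
  rw [mutualInfo_margUY, push_fst_mixture hk, margUY, entropy_mixture hk (fun _ z => z.2)]
  change _ + _ - (_ + ∑ u, v u * entropy (push Prod.snd (k u))) = _
  ring

theorem divReal_mixture (P : X × Y → ℝ) (hk : ∀ u, v u ≠ 0 → ∑ z, k u z = 1) :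
    divReal P (fun w : U × X × Y => v w.1 * k w.1 w.2) =
      ∑ u, v u * entropy (push Prod.snd (k u)) - ∑ u, v u * entropy (k u)
        - entropy (margY fun w : U × X × Y => v w.1 * k w.1 w.2)
        - ∑ z, push Prod.snd (fun w : U × X × Y => v w.1 * k w.1 w.2) z * Real.logb 2 (P z) := by
  have h := entropy_mixture hk (fun _ z => z)
  simp only [push_id, Prod.mk.eta] at h
  rw [divReal, sum_logb_eq, h, margUY, entropy_mixture hk (fun _ z => z.2)]
  change _ + ∑ u, v u * entropy (push Prod.snd (k u)) - _ - _ - _ = _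
  ring

/-- Relabelling the auxiliary variable injectively on the support of the law. -/
theorem relabel_aux {V : Type*} [Fintype V] (P : X × Y → ℝ) {p : U × X × Y → ℝ} {e : U → V}
    (he : ∀ a b, p a ≠ 0 → p b ≠ 0 → e a.1 = e b.1 → a.1 = b.1) :
    condEntropy (margUX (push (fun w => (e w.1, w.2)) p)) = condEntropy (margUX p) ∧
      mutualInfo (margUY (push (fun w => (e w.1, w.2)) p)) = mutualInfo (margUY p) ∧
      divReal P (push (fun w => (e w.1, w.2)) p) = divReal P p ∧
      push Prod.snd (push (fun w => (e w.1, w.2)) p) = push Prod.snd p := by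
  have he' : ∀ a b, p a ≠ 0 → p b ≠ 0 → (e a.1 = e b.1 ↔ a.1 = b.1) := fun a b ha hb =>
    ⟨he a b ha hb, fun h => by rw [h]⟩
  have hsnd : push Prod.snd (push (fun w => (e w.1, w.2)) p) = push Prod.snd p := by
    rw [push_push]; rfl
  have hY : margY (push (fun w => (e w.1, w.2)) p) = margY p := by
    rw [margY_eq_push_snd, hsnd, ← margY_eq_push_snd]
  have h1 : entropy (push Prod.fst (push (fun w => (e w.1, w.2)) p)) = entropy (push Prod.fst p) := by
    rw [push_push]
    exact entropy_push_congr fun a b ha hb => he' a b ha hb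
  have h2 : entropy (margUY (push (fun w => (e w.1, w.2)) p)) = entropy (margUY p) := by
    rw [margUY, push_push]
    exact entropy_push_congr fun a b ha hb => by simp [he' a b ha hb]
  refine ⟨?_, ?_, ?_, hsnd⟩
  · rw [condEntropy_margUX, condEntropy_margUX, h1, push_push]
    congr 1
    exact entropy_push_congr fun a b ha hb => by simp [he' a b ha hb]
  · rw [mutualInfo_margUY, mutualInfo_margUY, h1, h2, hY]
  · rw [divReal, divReal, sum_logb_eq, sum_logb_eq, hsnd, h2, hY]
    congr 3
    rw [← push_id p, push_push, push_id]
    conv_rhs => rw [← push_id p]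
    exact entropy_push_congr fun a b ha hb => by simp [he' a b ha hb, Prod.ext_iff]

theorem push_fst_eq_zero_iff {p : U × X × Y → ℝ} (hp : ∀ w, 0 ≤ p w) (u : U) :
    push Prod.fst p u = 0 ↔ ∀ z, p (u, z) = 0 := by
  rw [push_fst_apply, Finset.sum_eq_zero_iff_of_nonneg (fun z _ => hp _)]
  simp

/-- The alphabet of the auxiliary variable can be reduced to `|X||Y| + 2` letters. -/
theorem exists_reduced_alphabet (P : X × Y → ℝ) {p : U × X × Y → ℝ}
    (hp : p ∈ stdSimplex ℝ (U × X × Y)) :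
    ∃ p' ∈ stdSimplex ℝ (Fin (Fintype.card X * Fintype.card Y + 2) × X × Y),
      condEntropy (margUX p') ≤ condEntropy (margUX p) ∧
      mutualInfo (margUY p') = mutualInfo (margUY p) ∧
      divReal P p' = divReal P p ∧ push Prod.snd p' = push Prod.snd p := by
  classical
  set w : U → ℝ := push Prod.fst p with hw
  let k : U → X × Y → ℝ := fun u z => p (u, z) / w u
  have hw0 : ∀ u, 0 ≤ w u := push_nonneg _ hp.1
  have hk0 : ∀ u z, 0 ≤ k u z := fun u z => div_nonneg (hp.1 _) (hw0 u)
  have hk : ∀ u, w u ≠ 0 → ∑ z, k u z = 1 := by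
    intro u hu
    simp only [k]
    rw [← Finset.sum_div, ← push_fst_apply, ← hw, div_self hu]
  have hpk : p = fun a => w a.1 * k a.1 a.2 := by
    funext a
    by_cases hu : w a.1 = 0
    · rw [hu, zero_mul]
      exact (push_fst_eq_zero_iff hp.1 a.1).1 hu a.2
    · simp only [k]; field_simp
  -- The `|X||Y| + 2` constraints: the law of `XY`, then `H(XY | U)` and `H(Y | U)`. Total mass
  -- needs no constraint of its own, being the sum of the first `|X||Y|`, and `H(X | U)` is the
  -- objective.
  let A : U → (X × Y) ⊕ Fin 2 → ℝ := fun u => Sum.elim (k u)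
    ![entropy (k u), entropy (push Prod.snd (k u))]
  obtain ⟨v, hv0, hvw, hvA, hvc, hcard⟩ := exists_sparse_weights A
    (fun u => entropy (push Prod.fst (k u))) (Sum.elim (fun _ => 1) (fun _ => 0)) w hw0
    (fun u hu => by simpa [A] using hk u hu)
  have hkv : ∀ u, v u ≠ 0 → ∑ z, k u z = 1 := fun u hu => hk u fun h => hu (hvw u h)
  have hz : ∀ z, ∑ u, v u * k u z = ∑ u, w u * k u z := fun z => by simpa [A] using hvA (Sum.inl z)
  have hH : ∑ u, v u * entropy (k u) = ∑ u, w u * entropy (k u) := by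
    simpa [A] using hvA (Sum.inr 0)
  have hHY : ∑ u, v u * entropy (push Prod.snd (k u)) = ∑ u, w u * entropy (push Prod.snd (k u)) := by
    simpa [A] using hvA (Sum.inr 1)
  let p₁ : U × X × Y → ℝ := fun a => v a.1 * k a.1 a.2
  have hsnd : push Prod.snd p₁ = push Prod.snd p := by
    funext z
    rw [push_snd_apply, push_snd_apply, hpk]
    exact hz z
  have hY : margY p₁ = margY p := by rw [margY_eq_push_snd, hsnd, ← margY_eq_push_snd]
  have hp₁ : p₁ ∈ stdSimplex ℝ (U × X × Y) := by
    refine ⟨fun a => mul_nonneg (hv0 _) (hk0 _ _), ?_⟩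
    rw [← sum_push Prod.snd p₁, hsnd, sum_push, hp.2]
  have hcardN : (Finset.univ.filter fun u => v u ≠ 0).card ≤
      Fintype.card (Fin (Fintype.card X * Fintype.card Y + 2)) := by
    simpa using hcard
  obtain ⟨e, he⟩ : ∃ e : U → Fin (Fintype.card X * Fintype.card Y + 2),
      Set.InjOn e (Finset.univ.filter fun u => v u ≠ 0) := by
    obtain ⟨f, -, hf⟩ := Finset.exists_subset_card_eq hcardN
    obtain ⟨g⟩ : Nonempty ((Finset.univ.filter fun u => v u ≠ 0) ≃ f) :=
      ⟨Finset.equivOfCardEq (by rw [hf])⟩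
    refine ⟨fun u => if h : u ∈ Finset.univ.filter fun u => v u ≠ 0 then (g ⟨u, h⟩ : Fin _) else 0, ?_⟩
    intro a ha b hb hab
    have ha' := Finset.mem_coe.1 ha
    have hb' := Finset.mem_coe.1 hb
    simp only [dif_pos ha', dif_pos hb'] at hab
    simpa using g.injective (Subtype.ext hab)
  obtain ⟨r1, r2, r3, r4⟩ := relabel_aux P (p := p₁) (e := e) (by
    intro a b ha hb hab
    refine he ?_ ?_ hab
    · simpa using left_ne_zero_of_mul ha
    · simpa using left_ne_zero_of_mul hb)
  refine ⟨_, push_mem_stdSimplex _ hp₁, ?_, ?_, ?_, r4.trans hsnd⟩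
  · rw [r1, condEntropy_margUX_mixture hkv, hpk, condEntropy_margUX_mixture hk]
    exact hvc
  · rw [r2, mutualInfo_margUY_mixture hkv, hHY]
    change entropy (margY p₁) - _ = _
    rw [hY, hpk, mutualInfo_margUY_mixture hk]
  · rw [r3, divReal_mixture P hkv, hHY, hH]
    change _ - _ - entropy (margY p₁) - ∑ z, push Prod.snd p₁ z * _ = _
    rw [hY, hsnd, hpk, divReal_mixture P hk]

/-- Absolute continuity depends on the `XY`-marginal alone, so it survives the alphabet reduction.
-/
theorem suppLE_iff_push_snd {P : X × Y → ℝ} {p : U × X × Y → ℝ} (hp : ∀ w, 0 ≤ p w) :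
    SuppLE P p ↔ ∀ z, P z = 0 → push Prod.snd p z = 0 := by
  constructor
  · exact fun h z hz => push_eq_zero _ fun a ha => h a (ha ▸ hz)
  · intro h w hw
    exact le_antisymm ((le_push Prod.snd hp w).trans_eq (h _ hw)) (hp w)

end Reduction

/-! ### Attainment of the minimum -/

section Compactness

variable {X Y : Type*} [Fintype X] [Fintype Y]

/-- Laws on `Fin (|X||Y| + 2) × X × Y` that are feasible up to `γ` and have cost at most `γ`. -/
def nearOptimal (P : X × Y → ℝ) (R₁ R₂ γ : ℝ) :
    Set (Fin (Fintype.card X * Fintype.card Y + 2) × X × Y → ℝ) :=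
  {p | p ∈ stdSimplex ℝ (Fin (Fintype.card X * Fintype.card Y + 2) × X × Y) ∧ SuppLE P p ∧
    condEntropy (margUX p) ≤ R₁ + γ ∧
    divReal P p + max (mutualInfo (margUY p) - (R₂ + γ)) 0 ≤ γ}

theorem nearOptimal_mono (P : X × Y → ℝ) (R₁ R₂ : ℝ) {γ γ' : ℝ} (h : γ ≤ γ') :
    nearOptimal P R₁ R₂ γ ⊆ nearOptimal P R₁ R₂ γ' := by
  rintro p ⟨h1, h2, h3, h4⟩
  refine ⟨h1, h2, by linarith, ?_⟩
  have : max (mutualInfo (margUY p) - (R₂ + γ')) 0 ≤ max (mutualInfo (margUY p) - (R₂ + γ)) 0 :=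
    max_le_max (by linarith) le_rfl
  linarith

theorem continuous_condEntropy_margUX {U : Type*} [Fintype U] :
    Continuous fun p : U × X × Y → ℝ => condEntropy (margUX p) := by
  simp only [condEntropy_margUX]
  exact (continuous_entropy_push _).sub (continuous_entropy_push _)

theorem continuous_mutualInfo_margUY {U : Type*} [Fintype U] :
    Continuous fun p : U × X × Y → ℝ => mutualInfo (margUY p) := by
  have h : (fun p : U × X × Y → ℝ => mutualInfo (margUY p)) = fun p =>
      entropy (push Prod.fst p) + entropy (push (fun w => w.2.2) p)
        - entropy (push (fun w => (w.1, w.2.2)) p) := funext mutualInfo_margUY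
  rw [h]
  exact ((continuous_entropy_push _).add (continuous_entropy_push _)).sub
    (continuous_entropy_push _)

theorem continuous_divReal {U : Type*} [Fintype U] (P : X × Y → ℝ) :
    Continuous fun p : U × X × Y → ℝ => divReal P p := by
  have h : Continuous fun p : U × X × Y → ℝ => entropy p := by
    simpa only [push_id] using continuous_entropy_push (fun w : U × X × Y => w)
  simp only [divReal, margUY, margY]
  refine (((continuous_entropy_push _).sub h).sub (continuous_entropy_push _)).sub ?_
  fun_prop

theorem isClosed_nearOptimal (P : X × Y → ℝ) (R₁ R₂ γ : ℝ) :
    IsClosed (nearOptimal P R₁ R₂ γ) := by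
  refine (isClosed_stdSimplex _ _).inter (IsClosed.inter ?_ (IsClosed.inter ?_ ?_))
  · have h : {p : Fin (Fintype.card X * Fintype.card Y + 2) × X × Y → ℝ | SuppLE P p} =
        ⋂ w, ⋂ (_ : P w.2 = 0), {p | p w = 0} := by ext p; simp [SuppLE]
    change IsClosed {p : Fin (Fintype.card X * Fintype.card Y + 2) × X × Y → ℝ | SuppLE P p}
    rw [h]
    exact isClosed_iInter fun w => isClosed_iInter fun _ =>
      isClosed_eq (continuous_apply w) continuous_const
  · exact isClosed_le continuous_condEntropy_margUX continuous_const
  · exact isClosed_le ((continuous_divReal P).add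
      ((continuous_mutualInfo_margUY.sub continuous_const).max continuous_const)) continuous_const

theorem isCompact_nearOptimal (P : X × Y → ℝ) (R₁ R₂ γ : ℝ) :
    IsCompact (nearOptimal P R₁ R₂ γ) :=
  (isCompact_stdSimplex ℝ _).of_isClosed_subset (isClosed_nearOptimal P R₁ R₂ γ) fun _ h => h.1

/-- Cantor's intersection theorem for nested compact sets with slack `1/(k+1)`; a common point
satisfies the constraints in the limit. -/
theorem nearOptimal_zero_nonempty {P : X × Y → ℝ} {R₁ R₂ : ℝ}
    (h : ∀ γ > 0, (nearOptimal P R₁ R₂ γ).Nonempty) : (nearOptimal P R₁ R₂ 0).Nonempty := by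
  obtain ⟨p, hp⟩ := IsCompact.nonempty_iInter_of_sequence_nonempty_isCompact_isClosed
    (fun k : ℕ => nearOptimal P R₁ R₂ (1 / ((k : ℝ) + 1)))
    (fun k => nearOptimal_mono P R₁ R₂ (by push_cast; gcongr; linarith))
    (fun k => h _ (by positivity)) (isCompact_nearOptimal P R₁ R₂ _)
    (fun k => isClosed_nearOptimal P R₁ R₂ _)
  rw [Set.mem_iInter] at hp
  have ht : Tendsto (fun k : ℕ => 1 / ((k : ℝ) + 1)) atTop (nhds 0) :=
    tendsto_one_div_add_atTop_nhds_zero_nat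
  refine ⟨p, (hp 0).1, (hp 0).2.1, ?_, ?_⟩
  · exact ge_of_tendsto' (ht.const_add R₁) fun k => (hp k).2.2.1
  · have h1 : Tendsto (fun k : ℕ => 1 / ((k : ℝ) + 1) -
        max (mutualInfo (margUY p) - (R₂ + 1 / ((k : ℝ) + 1))) 0) atTop
        (nhds (0 - max (mutualInfo (margUY p) - (R₂ + 0)) 0)) :=
      ht.sub (((ht.const_add R₂).const_sub _).max tendsto_const_nhds)
    have := ge_of_tendsto' h1 (b := divReal P p) fun k => by linarith [(hp k).2.2.2]
    linarith

theorem exponentF_le_of_feasible {P : X × Y → ℝ} {R₁ R₂ : ℝ}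
    {p : Fin (Fintype.card X * Fintype.card Y + 2) × X × Y → ℝ}
    (hp : p ∈ stdSimplex ℝ (Fin (Fintype.card X * Fintype.card Y + 2) × X × Y))
    (hs : SuppLE P p) (hR : condEntropy (margUX p) ≤ R₁) :
    exponentF P R₁ R₂ ≤ ((divReal P p + max (mutualInfo (margUY p) - R₂) 0 : ℝ) : EReal) := by
  rw [← exponentCost_of_suppLE hp.1 hs]
  exact iInf_le_of_le _ (iInf_le_of_le le_rfl (iInf_le_of_le p (iInf_le_of_le hp
    (iInf_le_of_le hR le_rfl))))

/-- `F(R₁, R₂ | P) ≤ 0` means that the minimum is attained with cost `0`. -/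
theorem exponentF_nonpos_iff {P : X × Y → ℝ} {R₁ R₂ : ℝ} :
    exponentF P R₁ R₂ ≤ 0 ↔ (nearOptimal P R₁ R₂ 0).Nonempty := by
  constructor
  · intro h
    refine nearOptimal_zero_nonempty fun γ hγ => ?_
    have hlt : exponentF P R₁ R₂ < (γ : EReal) := h.trans_lt (by exact_mod_cast hγ)
    simp only [exponentF, iInf_lt_iff] at hlt
    obtain ⟨m, -, p, hp, hR, hcost⟩ := hlt
    have hs := suppLE_of_exponentCost_ne_top (hcost.trans (EReal.coe_lt_top _)).ne
    rw [exponentCost_of_suppLE hp.1 hs, EReal.coe_lt_coe_iff] at hcost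
    -- The witness lives on `Fin m` with `m` varying; reduction places all witnesses on one
    -- alphabet, where compactness can act.
    obtain ⟨p', hp', h1, h2, h3, h4⟩ := exists_reduced_alphabet P hp
    refine ⟨p', hp', ?_, ?_, ?_⟩
    · rw [suppLE_iff_push_snd hp'.1, h4]
      exact (suppLE_iff_push_snd hp.1).1 hs
    · linarith
    · rw [h2, h3]
      have : max (mutualInfo (margUY p) - (R₂ + γ)) 0 ≤ max (mutualInfo (margUY p) - R₂) 0 :=
        max_le_max (by linarith) le_rfl
      linarith
  · rintro ⟨p, hp, hs, hR, hc⟩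
    rw [add_zero] at hR hc
    exact (exponentF_le_of_feasible hp hs hR).trans (by exact_mod_cast hc)

end Compactness

/-! ### Prefixes of words, in a type independent of their length -/

section Mask

variable {n : ℕ} {A : Type*}

/-- The first `i` letters of a word, the others being hidden. -/
def mask (i : ℕ) (x : Fin n → A) : Fin n → Option A :=
  fun j => if j.val < i then some (x j) else none

theorem mask_eq_mask_iff {i : ℕ} {x x' : Fin n → A} :
    mask i x = mask i x' ↔ ∀ j : Fin n, j.val < i → x j = x' j := by
  simp only [mask, funext_iff]
  refine forall_congr' fun j => ?_
  by_cases h : j.val < i <;> simp [h]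

theorem mask_succ_eq_iff {i : Fin n} {x x' : Fin n → A} :
    mask (i + 1) x = mask (i + 1) x' ↔ x i = x' i ∧ mask i x = mask i x' := by
  simp only [mask_eq_mask_iff]
  constructor
  · exact fun h => ⟨h i (by omega), fun j hj => h j (by omega)⟩
  · rintro ⟨h1, h2⟩ j hj
    rcases Nat.lt_succ_iff_lt_or_eq.1 hj with h | h
    · exact h2 j h
    · rw [Fin.ext h, h1]

theorem mask_zero_eq (x x' : Fin n → A) : mask 0 x = mask 0 x' := by
  simp [mask_eq_mask_iff]

theorem mask_length_eq_iff {x x' : Fin n → A} : mask n x = mask n x' ↔ x = x' := by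
  rw [mask_eq_mask_iff, funext_iff]
  simp

theorem sum_fin_telescope (n : ℕ) (a : ℕ → ℝ) :
    ∑ i : Fin n, (a (i + 1) - a i) = a n - a 0 := by
  rw [Fin.sum_univ_eq_sum_range (fun i => a (i + 1) - a i), Finset.sum_range_sub]

end Mask

/-! ### Chain rules and single-letterization -/

section SingleLetter

variable {X Y S : Type*} [Fintype X] [Fintype Y] [Fintype S] {n : ℕ}

/-- The side information `g(yⁿ)` together with the first `i` letters of both words. -/
def auxVar (g : (Fin n → Y) → S) (i : ℕ) (w : (Fin n → X) × (Fin n → Y)) :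
    (Fin n → Option X) × (Fin n → Option Y) × S :=
  (mask i w.1, mask i w.2, g w.2)

variable {p : (Fin n → X) × (Fin n → Y) → ℝ}

/-- Chain rule for `H(Xⁿ | S)` along prefixes of `Xⁿ`; adding the prefix of `Yⁿ` to the conditioning
only lowers each term. -/
theorem sum_condEntropy_fst_le (hp : p ∈ stdSimplex ℝ ((Fin n → X) × (Fin n → Y)))
    (g : (Fin n → Y) → S) :
    ∑ i : Fin n, (entropy (push (fun w => (auxVar g i w, w.1 i)) p)
        - entropy (push (auxVar g i) p)) ≤
      entropy (push (fun w => (g w.2, w.1)) p) - entropy (push (fun w => g w.2) p) := by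
  have h0 : entropy (push (fun w => (mask 0 w.1, g w.2)) p) = entropy (push (fun w => g w.2) p) :=
    entropy_push_congr fun a b _ _ => by simp [mask_zero_eq a.1 b.1]
  have h1 : entropy (push (fun w => (mask n w.1, g w.2)) p) =
      entropy (push (fun w => (g w.2, w.1)) p) :=
    entropy_push_congr fun a b _ _ => by simp [mask_length_eq_iff, and_comm]
  rw [← h0, ← h1, ← sum_fin_telescope n fun i => entropy (push (fun w => (mask i w.1, g w.2)) p)]
  refine Finset.sum_le_sum fun i _ => ?_
  have key := entropy_submodular hp.1 (fun w => w.1 i) (fun w => mask i w.2)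
    (fun w => (mask i w.1, g w.2))
  have e1 : entropy (push (fun w => (w.1 i, mask i w.2, (mask i w.1, g w.2))) p) =
      entropy (push (fun w => (auxVar g i w, w.1 i)) p) :=
    entropy_push_congr fun a b _ _ => by simp only [auxVar, Prod.mk.injEq]; tauto
  have e2 : entropy (push (fun w => (w.1 i, (mask i w.1, g w.2))) p) =
      entropy (push (fun w => (mask (i + 1) w.1, g w.2)) p) :=
    entropy_push_congr fun a b _ _ => by simp only [mask_succ_eq_iff, Prod.mk.injEq]; tauto
  have e3 : entropy (push (fun w => (mask i w.2, (mask i w.1, g w.2))) p) =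
      entropy (push (auxVar g i) p) :=
    entropy_push_congr fun a b _ _ => by simp only [auxVar, Prod.mk.injEq]; tauto
  rw [e1, e2, e3] at key
  linarith

theorem entropy_snd_le (hp : p ∈ stdSimplex ℝ ((Fin n → X) × (Fin n → Y))) :
    entropy (push Prod.snd p) ≤ ∑ i : Fin n, entropy (push (fun w => w.2 i) p) := by
  have h0 : entropy (push (fun w => mask 0 w.2) p) = 0 := by
    have : entropy (push (fun w => mask 0 w.2) p) = entropy (push (fun _ => ()) p) :=
      entropy_push_congr fun a b _ _ => by simp [mask_zero_eq a.2 b.2]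
    rw [this]
    simp [entropy, push, hp.2]
  have h1 : entropy (push (fun w => mask n w.2) p) = entropy (push Prod.snd p) :=
    entropy_push_congr fun a b _ _ => by simp [mask_length_eq_iff]
  have ht := sum_fin_telescope n fun i => entropy (push (fun w => mask i w.2) p)
  simp only [h0, h1, sub_zero] at ht
  rw [← ht]
  refine Finset.sum_le_sum fun i _ => ?_
  have key := entropy_pair_le hp (fun w => w.2 i) (fun w => mask i w.2)
  have e1 : entropy (push (fun w => (w.2 i, mask i w.2)) p) =
      entropy (push (fun w => mask (i + 1) w.2) p) :=
    entropy_push_congr fun a b _ _ => by simp only [mask_succ_eq_iff, Prod.mk.injEq]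
  rw [e1] at key
  linarith

/-- Write the entropy as `H(Yⁿ) + ∑ H(X_i | X^{<i}, Yⁿ)`. The first term is subadditive, and in the
others `Yⁿ` determines `S`, `Y^{<i}` and `Y_i`, so conditioning on `U_i, Y_i` alone is weaker. -/
theorem entropy_le_sum_markov (hp : p ∈ stdSimplex ℝ ((Fin n → X) × (Fin n → Y)))
    (g : (Fin n → Y) → S) :
    entropy p ≤ ∑ i : Fin n, entropy (push (fun w => w.2 i) p) +
      ∑ i : Fin n, (entropy (push (fun w => (auxVar g i w, w.1 i, w.2 i)) p)
        - entropy (push (fun w => (auxVar g i w, w.2 i)) p)) := by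
  have h0 : entropy (push (fun w => (mask 0 w.1, w.2)) p) = entropy (push Prod.snd p) :=
    entropy_push_congr fun a b _ _ => by simp [mask_zero_eq a.1 b.1]
  have h1 : entropy (push (fun w => (mask n w.1, w.2)) p) = entropy p := by
    conv_rhs => rw [← push_id p]
    exact entropy_push_congr fun a b _ _ => by simp [mask_length_eq_iff, Prod.ext_iff]
  have ht := sum_fin_telescope n fun i => entropy (push (fun w => (mask i w.1, w.2)) p)
  simp only [h0, h1] at ht
  have hle : ∑ i : Fin n, (entropy (push (fun w => (mask (i + 1) w.1, w.2)) p)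
        - entropy (push (fun w => (mask i w.1, w.2)) p)) ≤
      ∑ i : Fin n, (entropy (push (fun w => (auxVar g i w, w.1 i, w.2 i)) p)
        - entropy (push (fun w => (auxVar g i w, w.2 i)) p)) := by
    refine Finset.sum_le_sum fun i _ => ?_
    have key := entropy_submodular hp.1 (fun w => w.1 i) Prod.snd
      (fun w => (auxVar g i w, w.2 i))
    have e1 : entropy (push (fun w => (w.1 i, w.2, (auxVar g i w, w.2 i))) p) =
        entropy (push (fun w => (mask (i + 1) w.1, w.2)) p) :=
      entropy_push_congr fun a b _ _ => by
        simp only [auxVar, mask_succ_eq_iff, Prod.mk.injEq]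
        refine ⟨by tauto, fun h => ?_⟩
        simp [h.1, h.2]
    have e2 : entropy (push (fun w => (w.1 i, (auxVar g i w, w.2 i))) p) =
        entropy (push (fun w => (auxVar g i w, w.1 i, w.2 i)) p) :=
      entropy_push_congr fun a b _ _ => by simp only [Prod.mk.injEq]; tauto
    have e3 : entropy (push (fun w => (w.2, (auxVar g i w, w.2 i))) p) =
        entropy (push (fun w => (mask i w.1, w.2)) p) :=
      entropy_push_congr fun a b _ _ => by
        simp only [auxVar, Prod.mk.injEq]
        refine ⟨by tauto, fun h => ?_⟩
        simp [h.1, h.2]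
    rw [e1, e2, e3] at key
    linarith
  have := entropy_snd_le hp
  linarith

/-- Chain rule that starts from `S`, a function of `Yⁿ`, and reveals one letter pair at a time. -/
theorem entropy_eq_sum_auxVar (p : (Fin n → X) × (Fin n → Y) → ℝ) (g : (Fin n → Y) → S) :
    entropy p = entropy (push (fun w => g w.2) p) +
      ∑ i : Fin n, (entropy (push (fun w => (auxVar g i w, w.1 i, w.2 i)) p)
        - entropy (push (auxVar g i) p)) := by
  have h0 : entropy (push (auxVar g 0) p) = entropy (push (fun w => g w.2) p) :=
    entropy_push_congr fun a b _ _ => by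
      simp [auxVar, mask_zero_eq a.1 b.1, mask_zero_eq a.2 b.2]
  have h1 : entropy (push (auxVar g n) p) = entropy p := by
    conv_rhs => rw [← push_id p]
    refine entropy_push_congr fun a b _ _ => ?_
    simp only [auxVar, mask_length_eq_iff, Prod.ext_iff]
    exact ⟨by tauto, fun h => by simp [h.1, h.2]⟩
  have ht := sum_fin_telescope n fun i => entropy (push (auxVar g i) p)
  simp only [h0, h1] at ht
  have he : ∀ i : Fin n, entropy (push (fun w => (auxVar g i w, w.1 i, w.2 i)) p) =
      entropy (push (auxVar g (i + 1)) p) := fun i =>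
    entropy_push_congr fun a b _ _ => by
      simp only [auxVar, mask_succ_eq_iff, Prod.mk.injEq]; tauto
  simp only [he, ht]
  ring

/-- The law of the auxiliary variable and the letter pair at a uniformly chosen time. -/
def timeSharing (g : (Fin n → Y) → S) (p : (Fin n → X) × (Fin n → Y) → ℝ) :
    (Fin n × (Fin n → Option X) × (Fin n → Option Y) × S) × X × Y → ℝ :=
  push (fun v : Fin n × (Fin n → X) × (Fin n → Y) =>
    ((v.1, auxVar g v.1 v.2), v.2.1 v.1, v.2.2 v.1)) (fun v => 1 / (n : ℝ) * p v.2)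

theorem timeSharing_base_mem (hn : 1 ≤ n)
    (hp : p ∈ stdSimplex ℝ ((Fin n → X) × (Fin n → Y))) :
    (fun v : Fin n × (Fin n → X) × (Fin n → Y) => 1 / (n : ℝ) * p v.2) ∈ stdSimplex ℝ _ := by
  refine ⟨fun v => mul_nonneg (by positivity) (hp.1 _), ?_⟩
  have : (n : ℝ) ≠ 0 := by positivity
  simp only [Fintype.sum_prod_type (f := fun v : Fin n × (Fin n → X) × (Fin n → Y) =>
    1 / (n : ℝ) * p v.2), ← Finset.mul_sum, hp.2]
  simp [this]

/-- The entropy of a variable that determines the time. -/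
theorem entropy_push_time {C D : Type*} [Fintype C] [Fintype D]
    (hp : p ∈ stdSimplex ℝ ((Fin n → X) × (Fin n → Y)))
    (f : Fin n → (Fin n → X) × (Fin n → Y) → C)
    (F : Fin n × (Fin n → X) × (Fin n → Y) → D)
    (h : ∀ a b, F a = F b ↔ a.1 = b.1 ∧ f a.1 a.2 = f b.1 b.2) :
    entropy (push F (fun v => 1 / (n : ℝ) * p v.2)) =
      entropy (fun _ : Fin n => 1 / (n : ℝ)) + 1 / n * ∑ i, entropy (push (f i) p) := by
  rw [Finset.mul_sum, ← entropy_mixture (k := fun _ => p) (fun _ _ => hp.2) f]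
  exact entropy_push_congr fun a b _ _ => by simp [h]

/-- This is `H(Y_T | T) ≤ H(Y_T)`: subadditivity for the pair `(T, Y_T)`, from which the entropy of
`T` cancels. -/
theorem sum_entropy_snd_le_timeSharing (hn : 1 ≤ n)
    (hp : p ∈ stdSimplex ℝ ((Fin n → X) × (Fin n → Y))) (g : (Fin n → Y) → S) :
    1 / n * ∑ i : Fin n, entropy (push (fun w => w.2 i) p) ≤ entropy (margY (timeSharing g p)) := by
  have hb := timeSharing_base_mem hn hp
  have h := entropy_pair_le hb (fun v => v.1) (fun v => v.2.2 v.1)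
  rw [entropy_push_time hp (fun i w => w.2 i) _ (by simp)] at h
  have e1 : push (fun v : Fin n × (Fin n → X) × (Fin n → Y) => v.1)
      (fun v => 1 / (n : ℝ) * p v.2) = fun _ => 1 / (n : ℝ) := by
    funext i
    have := push_fst_apply (fun v : Fin n × (Fin n → X) × (Fin n → Y) => 1 / (n : ℝ) * p v.2) i
    rw [← Finset.mul_sum, hp.2, mul_one] at this
    exact this
  rw [e1] at h
  rw [margY, timeSharing, push_push]
  simp only [Function.comp_def]
  linarith

theorem sum_logb_timeSharing {P : X × Y → ℝ} (hs : ∀ w, iid P n w = 0 → p w = 0)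
    (g : (Fin n → Y) → S) :
    ∑ w, timeSharing g p w * Real.logb 2 (P w.2) =
      1 / n * ∑ w, p w * Real.logb 2 (iid P n w) := by
  rw [timeSharing, sum_push_mul, Fintype.sum_prod_type, Finset.sum_comm, Finset.mul_sum]
  refine Finset.sum_congr rfl fun w _ => ?_
  by_cases hw : p w = 0
  · simp [hw]
  have h0 : iid P n w ≠ 0 := fun h => hw (hs w h)
  rw [iid, Real.logb_prod (hf := fun i _ => (Finset.prod_ne_zero_iff.1 h0) i (Finset.mem_univ i)),
    Finset.mul_sum, Finset.mul_sum]
  exact Finset.sum_congr rfl fun i _ => by ring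

theorem suppLE_timeSharing {S : Type*} {P : X × Y → ℝ} (hs : ∀ w, iid P n w = 0 → p w = 0)
    (g : (Fin n → Y) → S) : SuppLE P (timeSharing g p) := by
  intro w hw
  refine push_eq_zero _ fun v hv => ?_
  rw [hs v.2, mul_zero]
  refine Finset.prod_eq_zero (Finset.mem_univ v.1) ?_
  rw [← hv] at hw
  exact hw

/-- Single-letterization of a law on `Xⁿ × Yⁿ` and a function `g` of `Yⁿ`. -/
theorem timeSharing_bounds {P : X × Y → ℝ} (hn : 1 ≤ n)
    (hp : p ∈ stdSimplex ℝ ((Fin n → X) × (Fin n → Y))) (hs : ∀ w, iid P n w = 0 → p w = 0)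
    (g : (Fin n → Y) → S) :
    n * condEntropy (margUX (timeSharing g p)) ≤
        entropy (push (fun w => (g w.2, w.1)) p) - entropy (push (fun w => g w.2) p) ∧
      n * divReal P (timeSharing g p) ≤ -entropy p - ∑ w, p w * Real.logb 2 (iid P n w) ∧
      n * (divReal P (timeSharing g p) + mutualInfo (margUY (timeSharing g p))) ≤
        entropy (push (fun w => g w.2) p) - entropy p - ∑ w, p w * Real.logb 2 (iid P n w) := by
  have hn0 : (n : ℝ) ≠ 0 := by positivity
  -- In this and the next three identities the entropy of the uniform time is the same summand; it
  -- cancels in every difference below.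
  have hU : entropy (push Prod.fst (timeSharing g p)) =
      entropy (fun _ : Fin n => 1 / (n : ℝ)) + 1 / n * ∑ i : Fin n, entropy (push (auxVar g i) p) := by
    rw [timeSharing, push_push]
    exact entropy_push_time hp (fun i => auxVar g i) _ (by simp)
  have hUX : entropy (push (fun w => (w.1, w.2.1)) (timeSharing g p)) =
      entropy (fun _ : Fin n => 1 / (n : ℝ)) +
        1 / n * ∑ i : Fin n, entropy (push (fun w => (auxVar g i w, w.1 i)) p) := by
    rw [timeSharing, push_push]
    exact entropy_push_time hp (fun i w => (auxVar g i w, w.1 i)) _ (by simp; tauto)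
  have hUY : entropy (margUY (timeSharing g p)) =
      entropy (fun _ : Fin n => 1 / (n : ℝ)) +
        1 / n * ∑ i : Fin n, entropy (push (fun w => (auxVar g i w, w.2 i)) p) := by
    rw [margUY, timeSharing, push_push]
    exact entropy_push_time hp (fun i w => (auxVar g i w, w.2 i)) _ (by simp; tauto)
  have hUXY : entropy (timeSharing g p) =
      entropy (fun _ : Fin n => 1 / (n : ℝ)) +
        1 / n * ∑ i : Fin n, entropy (push (fun w => (auxVar g i w, w.1 i, w.2 i)) p) := by
    rw [timeSharing]
    exact entropy_push_time hp (fun i w => (auxVar g i w, w.1 i, w.2 i)) _ (by simp; tauto)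
  have hY := sum_entropy_snd_le_timeSharing hn hp g
  have hP := sum_logb_timeSharing hs g
  have k1 := sum_condEntropy_fst_le hp g
  have k2 := entropy_le_sum_markov hp g
  have k3 := entropy_eq_sum_auxVar p g
  rw [Finset.sum_sub_distrib] at k1 k2 k3
  have hnpos : (0 : ℝ) < n := by positivity
  refine ⟨?_, ?_, ?_⟩
  · rw [condEntropy_margUX, hU, hUX]
    refine le_trans (le_of_eq ?_) k1
    field_simp; ring
  · rw [divReal, hUY, hUXY, hP]
    rw [div_mul_eq_mul_div, one_mul, div_le_iff₀ hnpos] at hY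
    rw [mul_sub, mul_sub, mul_sub]
    field_simp
    linarith
  -- `H(Y)` and `H(UY)` cancel between divergence and mutual information, so this bound is an
  -- equality.
  · rw [divReal, mutualInfo_margUY, hUY, hUXY, hU, hP, k3]
    refine le_of_eq ?_
    field_simp; ring

end SingleLetter

/-! ### Strong converse by conditioning on success -/

section StrongConverse

variable {X Y : Type*} [Fintype X] [Fintype Y] {n : ℕ}

theorem iid_nonneg {X Y : Type*} {P : X × Y → ℝ} (hP : ∀ z, 0 ≤ P z) (n : ℕ)
    (w : (Fin n → X) × (Fin n → Y)) : 0 ≤ iid P n w :=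
  Finset.prod_nonneg fun _ _ => hP _

theorem sum_iid (P : X × Y → ℝ) (n : ℕ) : ∑ w, iid P n w = (∑ z, P z) ^ n := by
  classical
  have h := Finset.prod_univ_sum (fun _ : Fin n => (Finset.univ : Finset (X × Y))) (fun _ z => P z)
  rw [Finset.prod_const, Finset.card_univ, Fintype.card_fin, Fintype.piFinset_univ] at h
  rw [h, ← (Equiv.arrowProdEquivProdArrow (Fin n) (fun _ => X) (fun _ => Y)).sum_comp]
  rfl

theorem iid_mem_stdSimplex {P : X × Y → ℝ} (hP : P ∈ stdSimplex ℝ (X × Y)) (n : ℕ) :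
    iid P n ∈ stdSimplex ℝ ((Fin n → X) × (Fin n → Y)) :=
  ⟨iid_nonneg hP.1 n, by rw [sum_iid, hP.2, one_pow]⟩

/-- The law `q` conditioned on the event `E`. -/
theorem exists_conditioned_law {Ω : Type*} [Fintype Ω] {q : Ω → ℝ} (hq : ∀ a, 0 ≤ q a)
    {E : Ω → Prop} (hE : 0 < prob q E) :
    ∃ p ∈ stdSimplex ℝ Ω, (∀ a, p a ≠ 0 → E a ∧ q a ≠ 0) ∧
      -entropy p - ∑ a, p a * Real.logb 2 (q a) = -Real.logb 2 (prob q E) := by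
  classical
  -- On its support the density with respect to `q` is the constant `1 / q(E)`; hence the divergence
  -- is `-log q(E)`.
  let p : Ω → ℝ := fun a => (if E a then q a else 0) / prob q E
  have hp1 : ∑ a, p a = 1 := by
    simp only [p, ← Finset.sum_div]
    exact div_self hE.ne'
  have hpE : ∀ a, p a ≠ 0 → E a ∧ q a ≠ 0 := by
    intro a ha
    have h := (div_ne_zero_iff.1 ha).1
    by_cases hEa : E a
    · simpa [hEa] using h
    · simp [hEa] at h
  refine ⟨p, ⟨fun a => div_nonneg (by split_ifs <;> simp [hq]) hE.le, hp1⟩, hpE, ?_⟩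
  have : -Real.logb 2 (prob q E) = ∑ a, p a * -Real.logb 2 (prob q E) := by
    rw [← Finset.sum_mul, hp1, one_mul]
  rw [this, entropy, ← Finset.sum_neg_distrib, ← Finset.sum_sub_distrib]
  refine Finset.sum_congr rfl fun a _ => ?_
  by_cases ha : p a = 0
  · simp [ha]
  obtain ⟨h1, h2⟩ := hpE a ha
  have : Real.logb 2 (p a) = Real.logb 2 (q a) - Real.logb 2 (prob q E) := by
    simp only [p, h1, if_true]
    exact Real.logb_div h2 hE.ne'
  rw [this]; ring

/-- If lists of size `2 ^ (n r₁)`, selected by `2 ^ (n r₂)` messages about `Yⁿ`, contain `Xⁿ` with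
positive probability, then some feasible single-letter law bounds that probability. -/
theorem exists_law_of_list_decoding {S : Type*} [Fintype S] {P : X × Y → ℝ}
    (hP : P ∈ stdSimplex ℝ (X × Y)) (hn : 1 ≤ n) (g : (Fin n → Y) → S)
    (T : S → Finset (Fin n → X)) {r₁ r₂ : ℝ}
    (hT : ∀ s, ((T s).card : ℝ) ≤ (2 : ℝ) ^ ((n : ℝ) * r₁))
    (hS : (Fintype.card S : ℝ) ≤ (2 : ℝ) ^ ((n : ℝ) * r₂))
    (hpos : 0 < prob (iid P n) fun w => w.1 ∈ T (g w.2)) :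
    ∃ p ∈ stdSimplex ℝ (Fin (Fintype.card X * Fintype.card Y + 2) × X × Y), SuppLE P p ∧
      condEntropy (margUX p) ≤ r₁ ∧
      n * (divReal P p + max (mutualInfo (margUY p) - r₂) 0) ≤
        -Real.logb 2 (prob (iid P n) fun w => w.1 ∈ T (g w.2)) := by
  obtain ⟨q, hq, hqE, hqD⟩ := exists_conditioned_law (iid_nonneg hP.1 n) hpos
  have hqs : ∀ w, iid P n w = 0 → q w = 0 := fun w hw => by
    by_contra h
    exact (hqE w h).2 hw
  obtain ⟨b1, b2, b3⟩ := timeSharing_bounds hn hq hqs g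
  have hts : timeSharing g q ∈ stdSimplex ℝ _ :=
    push_mem_stdSimplex _ (timeSharing_base_mem hn hq)
  obtain ⟨p, hp, h1, h2, h3, h4⟩ := exists_reduced_alphabet P hts
  have hnpos : (0 : ℝ) < n := by positivity
  refine ⟨p, hp, ?_, ?_, ?_⟩
  · rw [suppLE_iff_push_snd hp.1, h4]
    exact (suppLE_iff_push_snd hts.1).1 (suppLE_timeSharing hqs g)
  · have hc := condEntropy_le_of_card_le hq (fun w => g w.2) (fun w => w.1) (T := T)
      (fun a ha => (hqE a ha).1) hT
    have := le_of_mul_le_mul_left (b1.trans hc) hnpos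
    linarith
  · have hS' := entropy_le_of_card_le (push_mem_stdSimplex (fun w => g w.2) hq) hS
    rw [h2, h3, ← hqD]
    -- The two branches of the positive part use `b2` and `b3` respectively; the second also needs
    -- `H(S) ≤ n r₂`.
    rcases le_total (mutualInfo (margUY (timeSharing g q)) - r₂) 0 with h | h
    · rw [max_eq_right h]; linarith
    · rw [max_eq_left h]; linarith

/-- The strong converse: the probability of correct list decoding is at most `2 ^ (-n F)`. -/
theorem prob_list_decoding_le {S : Type*} [Fintype S] {P : X × Y → ℝ}
    (hP : P ∈ stdSimplex ℝ (X × Y)) (hn : 1 ≤ n) (g : (Fin n → Y) → S)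
    (T : S → Finset (Fin n → X)) {r₁ r₂ : ℝ}
    (hT : ∀ s, ((T s).card : ℝ) ≤ (2 : ℝ) ^ ((n : ℝ) * r₁))
    (hS : (Fintype.card S : ℝ) ≤ (2 : ℝ) ^ ((n : ℝ) * r₂)) :
    prob (iid P n) (fun w => w.1 ∈ T (g w.2)) ≤
      twoPowNeg ((n : EReal) * exponentF P r₁ r₂) := by
  rcases (prob_nonneg (iid_nonneg hP.1 n) fun w => w.1 ∈ T (g w.2)).eq_or_lt with h0 | hpos
  · rw [← h0, twoPowNeg]
    split_ifs
    · rfl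
    · positivity
  obtain ⟨p, hp, hs, hR, hb⟩ := exists_law_of_list_decoding hP hn g T hT hS hpos
  have hF := exponentF_le_of_feasible (R₂ := r₂) hp hs hR
  have hF0 := exponentF_nonneg hP r₁ r₂
  -- A feasible law of finite cost exists because the success probability is positive, so the
  -- exponent is a real number.
  obtain ⟨F, hFe⟩ : ∃ F : ℝ, exponentF P r₁ r₂ = F :=
    ⟨_, (EReal.coe_toReal (hF.trans_lt (EReal.coe_lt_top _)).ne
      ((EReal.bot_lt_zero.trans_le hF0).ne')).symm⟩
  rw [hFe, EReal.coe_le_coe_iff] at hF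
  have hmul : (n : EReal) * (F : EReal) = ((n * F : ℝ) : EReal) := by
    rw [EReal.coe_mul]; rfl
  rw [hFe, hmul, twoPowNeg, if_neg (EReal.coe_ne_top _), EReal.toReal_coe]
  rw [← Real.logb_le_iff_le_rpow (by norm_num) hpos]
  have := mul_le_mul_of_nonneg_left hF (Nat.cast_nonneg (α := ℝ) n)
  linarith

end StrongConverse

/-! ### Leftover hashing for unnormalized measures -/

section LeftoverHash

variable {A K : Type*} [Fintype A] [DecidableEq A] [Fintype K]

/-- The deviation from uniformity, averaged over the hash function, of the image of the measure
`c`. -/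
def hashDev (Q : (A → K) → ℝ) (c : A → ℝ) : ℝ :=
  ∑ f, ∑ k, Q f * |push f c k - (∑ a, c a) / Fintype.card K|

theorem hashDev_add_le {Q : (A → K) → ℝ} (hQ : ∀ f, 0 ≤ Q f) (c d : A → ℝ) :
    hashDev Q (fun a => c a + d a) ≤ hashDev Q c + hashDev Q d := by
  simp only [hashDev, ← Finset.sum_add_distrib, ← mul_add]
  refine Finset.sum_le_sum fun f _ => Finset.sum_le_sum fun k _ =>
    mul_le_mul_of_nonneg_left ?_ (hQ f)
  refine le_trans (le_of_eq (congrArg _ ?_)) (abs_add_le _ _)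
  have : push f (fun a => c a + d a) k = push f c k + push f d k := by
    simp only [push, ← Finset.sum_add_distrib]
    exact Finset.sum_congr rfl fun a _ => by split_ifs <;> simp
  rw [this, Finset.sum_add_distrib]; ring

/-- The trivial bound by the triangle inequality; it serves the heavy words, where hashing gives
nothing. -/
theorem hashDev_le_two_mul {Q : (A → K) → ℝ} (hQ : Q ∈ stdSimplex ℝ (A → K))
    (hK : 0 < Fintype.card K) {c : A → ℝ} (hc : ∀ a, 0 ≤ c a) :
    hashDev Q c ≤ 2 * ∑ a, c a := by
  have hK' : (Fintype.card K : ℝ) ≠ 0 := by positivity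
  have hC : 0 ≤ ∑ a, c a := Finset.sum_nonneg fun a _ => hc a
  calc hashDev Q c ≤ ∑ f, Q f * (2 * ∑ a, c a) := by
        refine Finset.sum_le_sum fun f _ => ?_
        rw [← Finset.mul_sum]
        refine mul_le_mul_of_nonneg_left ?_ (hQ.1 f)
        calc ∑ k, |push f c k - (∑ a, c a) / Fintype.card K|
            ≤ ∑ k, (push f c k + (∑ a, c a) / Fintype.card K) := by
              refine Finset.sum_le_sum fun k _ => ?_
              have h1 := push_nonneg f hc k
              have h2 : 0 ≤ (∑ a, c a) / Fintype.card K := by positivity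
              rw [abs_le]; constructor <;> linarith
          _ = 2 * ∑ a, c a := by
              rw [Finset.sum_add_distrib, sum_push, Finset.sum_const, Finset.card_univ,
                nsmul_eq_mul, mul_div_cancel₀ _ hK']
              ring
    _ = 2 * ∑ a, c a := by rw [← Finset.sum_mul, hQ.2, one_mul]

theorem sum_push_sq {A : Type*} [Fintype A] (f : A → K) (c : A → ℝ) :
    ∑ k, push f c k ^ 2 = ∑ a, ∑ a', c a * c a' * (open Classical in if f a = f a' then 1 else 0) := by
  classical
  have h := sum_push_mul f c (push f c)
  simp only [sq]
  rw [h]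
  refine Finset.sum_congr rfl fun a _ => ?_
  rw [push, Finset.mul_sum]
  refine Finset.sum_congr rfl fun a' _ => ?_
  by_cases e : f a = f a'
  · simp [e]
  · simp [e, Ne.symm e]

/-- The expected squared bin masses are collision sums. Universality bounds the off-diagonal pairs
by `C²/|K|`, which the centering subtracts, so only the diagonal remains. -/
theorem universal_second_moment {Q : (A → K) → ℝ} (hQ : Q ∈ stdSimplex ℝ (A → K))
    (hu : IsUniversalHash Q) (hK : 0 < Fintype.card K) {c : A → ℝ} (hc : ∀ a, 0 ≤ c a) :
    ∑ f, ∑ k, Q f * (push f c k - (∑ a, c a) / Fintype.card K) ^ 2 ≤ ∑ a, c a ^ 2 := by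
  classical
  have hK' : (Fintype.card K : ℝ) ≠ 0 := by positivity
  set C := ∑ a, c a with hC
  have h1 : ∀ f : A → K, ∑ k, (push f c k - C / Fintype.card K) ^ 2 =
      ∑ k, push f c k ^ 2 - C ^ 2 / Fintype.card K := by
    intro f
    have : ∀ k, (push f c k - C / Fintype.card K) ^ 2 =
        push f c k ^ 2 - push f c k * (2 * C / Fintype.card K) + C ^ 2 / Fintype.card K ^ 2 := by
      intro k; ring
    simp only [this, Finset.sum_add_distrib, Finset.sum_sub_distrib, ← Finset.sum_mul, sum_push,
      Finset.sum_const, Finset.card_univ, nsmul_eq_mul, ← hC]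
    field_simp; ring
  have h2 : ∑ f, Q f * ∑ k, push f c k ^ 2 =
      ∑ a, ∑ a', c a * c a' * prob Q (fun f => f a = f a') := by
    simp only [sum_push_sq, Finset.mul_sum, prob]
    rw [Finset.sum_comm]
    refine Finset.sum_congr rfl fun a _ => ?_
    rw [Finset.sum_comm]
    refine Finset.sum_congr rfl fun a' _ => Finset.sum_congr rfl fun f _ => ?_
    by_cases e : f a = f a' <;> simp [e, mul_comm]
  have h3 : ∀ a a', prob Q (fun f => f a = f a') ≤
      (if a = a' then 1 else 0) + 1 / (Fintype.card K : ℝ) := by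
    intro a a'
    by_cases e : a = a'
    · subst e
      have : prob Q (fun f => f a = f a) = 1 := by simp [prob, hQ.2]
      rw [this, if_pos rfl]
      linarith [show (0 : ℝ) ≤ 1 / (Fintype.card K : ℝ) by positivity]
    · simpa [e] using hu a a' e
  have h4 : ∑ a, ∑ a', c a * c a' * prob Q (fun f => f a = f a') ≤
      ∑ a, c a ^ 2 + C ^ 2 / Fintype.card K := by
    calc ∑ a, ∑ a', c a * c a' * prob Q (fun f => f a = f a')
        ≤ ∑ a, ∑ a', c a * c a' * ((if a = a' then 1 else 0) + 1 / (Fintype.card K : ℝ)) :=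
          Finset.sum_le_sum fun a _ => Finset.sum_le_sum fun a' _ =>
            mul_le_mul_of_nonneg_left (h3 a a') (mul_nonneg (hc a) (hc a'))
      _ = _ := by
          simp only [mul_add, Finset.sum_add_distrib, mul_ite, mul_one, mul_zero,
            Finset.sum_ite_eq, Finset.mem_univ, if_true, ← Finset.sum_mul, ← Finset.mul_sum, ← hC]
          simp only [sq]; ring
  calc ∑ f, ∑ k, Q f * (push f c k - C / Fintype.card K) ^ 2
      = ∑ f, Q f * ∑ k, push f c k ^ 2 - C ^ 2 / Fintype.card K := by
        simp only [← Finset.mul_sum, h1, mul_sub, Finset.sum_sub_distrib, ← Finset.sum_mul, hQ.2,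
          one_mul]
    _ ≤ ∑ a, c a ^ 2 := by rw [h2]; linarith

/-- The leftover hash lemma for an unnormalized measure. -/
theorem hashDev_le_sqrt {Q : (A → K) → ℝ} (hQ : Q ∈ stdSimplex ℝ (A → K))
    (hu : IsUniversalHash Q) (hK : 0 < Fintype.card K) {c : A → ℝ} (hc : ∀ a, 0 ≤ c a) :
    hashDev Q c ≤ √(Fintype.card K * ∑ a, c a ^ 2) := by
  refine Real.le_sqrt_of_sq_le ?_
  -- Cauchy-Schwarz over pairs `(f, k)` with weight `Q f`; the total weight is `|K|`.
  have cs := Finset.sum_sq_le_sum_mul_sum_of_sq_le_mul (Finset.univ : Finset ((A → K) × K))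
    (r := fun v => Q v.1 * |push v.1 c v.2 - (∑ a, c a) / Fintype.card K|)
    (f := fun v => Q v.1)
    (g := fun v => Q v.1 * (push v.1 c v.2 - (∑ a, c a) / Fintype.card K) ^ 2)
    (fun v _ => hQ.1 _) (fun v _ => mul_nonneg (hQ.1 _) (sq_nonneg _))
    (fun v _ => by rw [mul_pow, sq_abs]; exact le_of_eq (by ring))
  simp only [Fintype.sum_prod_type] at cs
  refine cs.trans ?_
  have h1 : ∑ f : A → K, ∑ _k : K, Q f = Fintype.card K := by
    simp [← Finset.mul_sum, hQ.2]
  rw [h1]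
  exact mul_le_mul_of_nonneg_left (universal_second_moment hQ hu hK hc) (Nat.cast_nonneg _)

end LeftoverHash

/-! ### The security bound -/

section Security

variable {X Y K S : Type*} [Fintype X] [DecidableEq X] [Fintype Y] [Fintype K] [Fintype S] {n : ℕ}

theorem keyLaw_apply (P : X × Y → ℝ) (g : (Fin n → Y) → S) (Q : ((Fin n → X) → K) → ℝ)
    (k : K) (s : S) (f : (Fin n → X) → K) :
    keyLaw P g Q (k, s, f) =
      Q f * push f (fun x => push (fun w => (w.1, g w.2)) (iid P n) (x, s)) k := by
  classical
  have h : push f (fun x => push (fun w => (w.1, g w.2)) (iid P n) (x, s)) k =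
      ∑ w : (Fin n → X) × (Fin n → Y), if f w.1 = k ∧ g w.2 = s then iid P n w else 0 := by
    have := sum_push_mul (fun w : (Fin n → X) × (Fin n → Y) => (w.1, g w.2)) (iid P n)
      (fun v => if f v.1 = k ∧ v.2 = s then 1 else 0)
    simp only [mul_ite, mul_one, mul_zero] at this
    rw [← this, Fintype.sum_prod_type, push]
    refine Finset.sum_congr rfl fun x _ => ?_
    by_cases e : f x = k <;> simp [e]
  rw [h, keyLaw, push, Fintype.sum_prod_type, Finset.mul_sum]
  refine Finset.sum_congr rfl fun w _ => ?_
  rw [Finset.sum_eq_single f (by intro f' _ hf'; simp [hf']) (by simp)]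
  by_cases e : f w.1 = k ∧ g w.2 = s
  · simp [e.1, e.2, mul_comm]
  · rw [if_neg e, if_neg (by simpa using e), mul_zero]

/-- As `F` is independent of the source and part of the output, the distance separates into one
hashing problem per value of `s`. -/
theorem securityDelta_eq (P : X × Y → ℝ) (g : (Fin n → Y) → S) {Q : ((Fin n → X) → K) → ℝ}
    (hQ : ∀ f, 0 ≤ Q f) :
    securityDelta P g Q =
      1 / 2 * ∑ s, hashDev Q fun x => push (fun w => (w.1, g w.2)) (iid P n) (x, s) := by
  have hS : ∀ s, push (fun v : (Fin n → X) × (Fin n → Y) => g v.2) (iid P n) s =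
      ∑ x, push (fun w : (Fin n → X) × (Fin n → Y) => (w.1, g w.2)) (iid P n) (x, s) := by
    intro s
    rw [← push_snd_apply, push_push]; rfl
  rw [securityDelta, dvar]
  congr 1
  simp only [Fintype.sum_prod_type, hashDev]
  rw [Finset.sum_comm]
  refine Finset.sum_congr rfl fun s _ => ?_
  rw [Finset.sum_comm]
  refine Finset.sum_congr rfl fun f _ => Finset.sum_congr rfl fun k _ => ?_
  rw [keyLaw_apply, idealLaw, ← hS]
  conv_rhs => rw [← abs_of_nonneg (hQ f), ← abs_mul]
  congr 1
  simp only; ring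

/-- Each counted atom carries more than a fraction `t` of the mass. The strict inequality makes the
set empty when the total mass is zero. -/
theorem card_filter_lt_le {A : Type*} [Fintype A] {c : A → ℝ} (hc : ∀ a, 0 ≤ c a) {t : ℝ}
    (ht : 0 < t) : (((Finset.univ.filter fun a => t * ∑ b, c b < c a).card : ℕ) : ℝ) ≤ t⁻¹ := by
  have hC : 0 ≤ ∑ b, c b := Finset.sum_nonneg fun a _ => hc a
  rcases hC.eq_or_lt with h0 | hpos
  · rw [Finset.filter_false_of_mem]
    · simp [ht.le]
    · intro a _
      rw [← h0, mul_zero, not_lt, h0]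
      exact Finset.single_le_sum (fun b _ => hc b) (Finset.mem_univ a)
  · have h1 : ((Finset.univ.filter fun a => t * ∑ b, c b < c a).card : ℝ) * (t * ∑ b, c b) ≤
        ∑ b, c b := by
      rw [← nsmul_eq_mul, ← Finset.sum_const]
      refine (Finset.sum_le_sum fun a ha => (Finset.mem_filter.1 ha).2.le).trans ?_
      exact Finset.sum_le_sum_of_subset_of_nonneg (Finset.filter_subset _ _) fun a _ _ => hc a
    rw [← mul_assoc] at h1
    have h2 := le_of_mul_le_mul_right (h1.trans_eq (one_mul _).symm) hpos
    rwa [← one_div, le_div_iff₀ ht]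

/-- The security bound in terms of the strong converse exponent. -/
theorem securityDelta_le {P : X × Y → ℝ} (hP : P ∈ stdSimplex ℝ (X × Y)) {R₁ R₂ δ : ℝ}
    (hn : 1 ≤ n) (g : (Fin n → Y) → S) {Q : ((Fin n → X) → K) → ℝ}
    (hKc : (Fintype.card K : ℝ) ≤ (2 : ℝ) ^ ((n : ℝ) * R₁))
    (hSc : (Fintype.card S : ℝ) ≤ (2 : ℝ) ^ ((n : ℝ) * R₂))
    (hQ : Q ∈ stdSimplex ℝ ((Fin n → X) → K)) (hu : IsUniversalHash Q) :
    securityDelta P g Q ≤ twoPowNeg ((n : EReal) * exponentF P (R₁ + δ) R₂)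
      + 1 / 2 * √((2 : ℝ) ^ (-((n : ℝ) * δ))) := by
  classical
  -- `P` and `Q` have mass one, so there are a letter of `X` and a map into `K`.
  have hK : 0 < Fintype.card K := by
    obtain ⟨z⟩ : Nonempty (X × Y) := by
      by_contra h
      rw [not_nonempty_iff] at h
      simpa using hP.2
    obtain ⟨f⟩ : Nonempty ((Fin n → X) → K) := by
      by_contra h
      rw [not_nonempty_iff] at h
      simpa using hQ.2
    exact Fintype.card_pos_iff.2 ⟨f fun _ => z.1⟩
  have hW := iid_mem_stdSimplex hP n
  set J : (Fin n → X) × S → ℝ := push (fun w => (w.1, g w.2)) (iid P n) with hJ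
  have hJm : J ∈ stdSimplex ℝ ((Fin n → X) × S) := push_mem_stdSimplex _ hW
  set t : ℝ := (2 : ℝ) ^ (-((n : ℝ) * (R₁ + δ))) with ht
  have ht0 : 0 < t := by positivity
  let m : S → ℝ := fun s => ∑ x, J (x, s)
  have hm0 : ∀ s, 0 ≤ m s := fun s => Finset.sum_nonneg fun x _ => hJm.1 _
  have hm1 : ∑ s, m s = 1 := by
    rw [← hJm.2, Fintype.sum_prod_type, Finset.sum_comm]
  -- The heavy words given `s`: conditional probability above `t = 2^(-n(R₁+δ))`. They form the list
  -- of a decoder that knows `s`.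
  let T : S → Finset (Fin n → X) := fun s => Finset.univ.filter fun x => t * m s < J (x, s)
  have hT : ∀ s, ((T s).card : ℝ) ≤ (2 : ℝ) ^ ((n : ℝ) * (R₁ + δ)) := by
    intro s
    refine (card_filter_lt_le (c := fun x => J (x, s)) (fun x => hJm.1 _) ht0).trans_eq ?_
    rw [ht, ← Real.rpow_neg (by norm_num), neg_neg]
  let J₁ : S → (Fin n → X) → ℝ := fun s x => if x ∈ T s then J (x, s) else 0
  let J₂ : S → (Fin n → X) → ℝ := fun s x => if x ∈ T s then 0 else J (x, s)
  have hJ₁ : ∀ s x, 0 ≤ J₁ s x := fun s x => by simp only [J₁]; split_ifs <;> simp [hJm.1]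
  have hJ₂ : ∀ s x, 0 ≤ J₂ s x := fun s x => by simp only [J₂]; split_ifs <;> simp [hJm.1]
  have hsplit : ∀ s, (fun x => J (x, s)) = fun x => J₁ s x + J₂ s x := fun s =>
    funext fun x => by simp only [J₁, J₂]; split_ifs <;> simp
  have hmass : ∑ s, ∑ x, J₁ s x = prob (iid P n) fun w => w.1 ∈ T (g w.2) := by
    have := prob_push (fun w : (Fin n → X) × (Fin n → Y) => (w.1, g w.2)) (iid P n)
      (fun v => v.1 ∈ T v.2)
    rw [← this, prob, Fintype.sum_prod_type, Finset.sum_comm]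
    refine Finset.sum_congr rfl fun x _ => Finset.sum_congr rfl fun s _ => ?_
    by_cases e : x ∈ T s <;> simp [J₁, hJ, e]
  -- Light words satisfy `J ≤ t m(s)`, so the second moment is at most `t m(s)²`, and `|K| t ≤
  -- 2^(-nδ)`.
  have hflat : ∀ s, hashDev Q (J₂ s) ≤ m s * √((2 : ℝ) ^ (-((n : ℝ) * δ))) := by
    intro s
    refine (hashDev_le_sqrt hQ hu hK (hJ₂ s)).trans ?_
    have hsq : ∑ x, J₂ s x ^ 2 ≤ t * m s ^ 2 := by
      calc ∑ x, J₂ s x ^ 2 ≤ ∑ x, (t * m s) * J (x, s) := by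
            refine Finset.sum_le_sum fun x _ => ?_
            have hnn := mul_nonneg (mul_nonneg ht0.le (hm0 s)) (hJm.1 (x, s))
            by_cases hx : x ∈ T s
            · simpa [J₂, hx] using hnn
            · have : J (x, s) ≤ t * m s := by simpa [T] using hx
              simp only [J₂, hx, if_false, sq]
              exact mul_le_mul_of_nonneg_right this (hJm.1 _)
        _ = t * m s ^ 2 := by rw [← Finset.mul_sum]; ring
    have hle : (Fintype.card K : ℝ) * ∑ x, J₂ s x ^ 2 ≤ m s ^ 2 * (2 : ℝ) ^ (-((n : ℝ) * δ)) := by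
      calc (Fintype.card K : ℝ) * ∑ x, J₂ s x ^ 2
          ≤ (2 : ℝ) ^ ((n : ℝ) * R₁) * (t * m s ^ 2) := by
            gcongr
        _ = m s ^ 2 * ((2 : ℝ) ^ ((n : ℝ) * R₁) * t) := by ring
        _ = _ := by
            rw [ht, ← Real.rpow_add (by norm_num)]
            congr 2; ring
    calc √((Fintype.card K : ℝ) * ∑ x, J₂ s x ^ 2)
        ≤ √(m s ^ 2 * (2 : ℝ) ^ (-((n : ℝ) * δ))) := Real.sqrt_le_sqrt hle
      _ = m s * √((2 : ℝ) ^ (-((n : ℝ) * δ))) := by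
          rw [Real.sqrt_mul (sq_nonneg _), Real.sqrt_sq (hm0 s)]
  have hall : ∑ s, hashDev Q (fun x => J (x, s)) ≤
      2 * (prob (iid P n) fun w => w.1 ∈ T (g w.2)) + √((2 : ℝ) ^ (-((n : ℝ) * δ))) := by
    calc ∑ s, hashDev Q (fun x => J (x, s))
        ≤ ∑ s, (2 * ∑ x, J₁ s x + m s * √((2 : ℝ) ^ (-((n : ℝ) * δ)))) := by
          refine Finset.sum_le_sum fun s _ => ?_
          rw [hsplit s]
          exact (hashDev_add_le hQ.1 _ _).trans
            (add_le_add (hashDev_le_two_mul hQ hK (hJ₁ s)) (hflat s))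
      _ = _ := by
          rw [Finset.sum_add_distrib, ← Finset.mul_sum, hmass, ← Finset.sum_mul, hm1, one_mul]
  have hlist := prob_list_decoding_le hP hn g T hT hSc
  rw [securityDelta_eq P g hQ.1]
  -- The factor `1/2` of the variation distance cancels the `2` in front of the heavy mass.
  linarith

end Security

/-! ### One-shot coding by random covering and binning -/

section OneShot

theorem exists_le_average {Ω : Type*} [Fintype Ω] {q : Ω → ℝ} (hq : q ∈ stdSimplex ℝ Ω)
    (φ : Ω → ℝ) : ∃ ω, φ ω ≤ ∑ ω, q ω * φ ω := by
  by_contra! hc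
  set a := ∑ ω, q ω * φ ω with ha
  have h0 : ∑ ω, q ω * (φ ω - a) = 0 := by
    simp only [mul_sub, Finset.sum_sub_distrib, ← Finset.sum_mul, hq.2, one_mul, ← ha, sub_self]
  rw [Finset.sum_eq_zero_iff_of_nonneg fun ω _ =>
    mul_nonneg (hq.1 ω) (sub_nonneg.2 (hc ω).le)] at h0
  have : ∑ ω, q ω = 0 := Finset.sum_eq_zero fun ω hω =>
    (mul_eq_zero.1 (h0 ω hω)).resolve_right (sub_pos.2 (hc ω)).ne'
  rw [hq.2] at this
  exact one_ne_zero this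

/-- Sums over words factor. -/
theorem sum_prod_fin {α : Type*} [Fintype α] (M : ℕ) (f : α → ℝ) :
    ∑ c : Fin M → α, ∏ m, f (c m) = (∑ a, f a) ^ M := by
  classical
  have h := Finset.prod_univ_sum (fun _ : Fin M => (Finset.univ : Finset α)) (fun _ a => f a)
  rw [Finset.prod_const, Finset.card_univ, Fintype.card_fin, Fintype.piFinset_univ] at h
  exact h.symm

theorem prod_mem_stdSimplex {α : Type*} [Fintype α] {q : α → ℝ} (hq : q ∈ stdSimplex ℝ α) (M : ℕ) :
    (fun c : Fin M → α => ∏ m, q (c m)) ∈ stdSimplex ℝ (Fin M → α) :=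
  ⟨fun _ => Finset.prod_nonneg fun _ _ => hq.1 _, by rw [sum_prod_fin, hq.2, one_pow]⟩

theorem prob_forall_fin {α : Type*} [Fintype α] (q : α → ℝ) (M : ℕ) (E : α → Prop) :
    prob (fun c : Fin M → α => ∏ m, q (c m)) (fun c => ∀ m, E (c m)) = prob q E ^ M := by
  classical
  rw [prob, prob, ← sum_prod_fin]
  refine Finset.sum_congr rfl fun c _ => ?_
  rw [Finset.prod_ite_zero]
  simp

/-- A random codebook covers every `y` about as well as independent trials do. -/
theorem exists_codebook {U Y : Type*} [Fintype U] [Fintype Y] {q : U → ℝ}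
    (hq : q ∈ stdSimplex ℝ U) (r : Y → ℝ) (A : U → Y → Prop) (M : ℕ) :
    ∃ c : Fin M → U, prob r (fun y => ∀ m, ¬ A (c m) y) ≤
      ∑ y, r y * prob q (fun u => ¬ A u y) ^ M := by
  classical
  obtain ⟨c, hc⟩ := exists_le_average (prod_mem_stdSimplex hq M)
    (fun c => prob r (fun y => ∀ m, ¬ A (c m) y))
  refine ⟨c, hc.trans_eq ?_⟩
  simp only [prob, Finset.mul_sum]
  rw [Finset.sum_comm]
  refine Finset.sum_congr rfl fun y _ => ?_
  have h := prob_forall_fin q M (fun u => ¬ A u y)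
  simp only [prob] at h
  rw [← h, Finset.mul_sum]
  refine Finset.sum_congr rfl fun c _ => ?_
  split_ifs <;> simp [mul_comm]

/-- A uniformly random function is universal: overwriting the value of a colliding `h` at `a` loses
nothing, since `h a` can be read off at `b`. -/
theorem card_collision_mul_le {X : Type*} [Fintype X] [DecidableEq X] {K : ℕ} {a b : X}
    (hab : a ≠ b) :
    (Finset.univ.filter fun h : X → Fin K => h a = h b).card * K ≤ Fintype.card (X → Fin K) := by
  have hinj : Function.Injective fun v : {h : X → Fin K // h a = h b} × Fin K =>
      Function.update v.1.1 a v.2 := by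
    rintro ⟨⟨h, hh⟩, j⟩ ⟨⟨h', hh'⟩, j'⟩ e
    simp only at e
    have hj : j = j' := by simpa using congrFun e a
    have hne : ∀ x, x ≠ a → h x = h' x := fun x hx => by
      simpa [Function.update_of_ne hx] using congrFun e x
    have : h = h' := by
      funext x
      by_cases hx : x = a
      · rw [hx, hh, hh', hne b hab.symm]
      · exact hne x hx
    simp [this, hj]
  have := Fintype.card_le_of_injective _ hinj
  rwa [Fintype.card_prod, Fintype.card_fin, Fintype.card_subtype] at this

/-- Random binning: some bin assignment separates `x` from the other elements of a short list. -/
theorem exists_binning {Ω X : Type*} [Fintype Ω] [Fintype X] {p : Ω → ℝ}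
    (hp : p ∈ stdSimplex ℝ Ω) (ξ : Ω → X) (T : Ω → Finset X) {L : ℝ}
    (hT : ∀ ω, ((T ω).card : ℝ) ≤ L) {K : ℕ} (hK : 0 < K) :
    ∃ h : X → Fin K, prob p (fun ω => ∃ x ∈ T ω, x ≠ ξ ω ∧ h x = h (ξ ω)) ≤ L / K := by
  classical
  have : Nonempty (Fin K) := ⟨⟨0, hK⟩⟩
  set N : ℝ := ((Fintype.card (X → Fin K) : ℕ) : ℝ) with hN
  have hN0 : 0 < N := by
    rw [hN]; exact_mod_cast Fintype.card_pos
  have hK0 : (0 : ℝ) < K := by exact_mod_cast hK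
  have hunif : (fun _ : X → Fin K => 1 / N) ∈ stdSimplex ℝ (X → Fin K) := by
    refine ⟨fun _ => by positivity, ?_⟩
    rw [Finset.sum_const, Finset.card_univ, nsmul_eq_mul, ← hN, mul_one_div_cancel hN0.ne']
  obtain ⟨h, hh⟩ := exists_le_average hunif
    (fun h => prob p (fun ω => ∃ x ∈ T ω, x ≠ ξ ω ∧ h x = h (ξ ω)))
  refine ⟨h, hh.trans ?_⟩
  have hcol : ∀ a b : X, a ≠ b →
      ∑ h : X → Fin K, 1 / N * (if h a = h b then (1 : ℝ) else 0) ≤ 1 / K := by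
    intro a b hab
    rw [← Finset.mul_sum, Finset.sum_boole, div_mul_eq_mul_div, one_mul,
      div_le_div_iff₀ hN0 hK0, one_mul]
    rw [hN]
    exact_mod_cast card_collision_mul_le (K := K) hab
  -- Union bound over the list, then the collision probability `1/K` for each wrong element.
  calc ∑ h : X → Fin K, 1 / N * prob p (fun ω => ∃ x ∈ T ω, x ≠ ξ ω ∧ h x = h (ξ ω))
      ≤ ∑ h : X → Fin K, 1 / N * ∑ ω, p ω *
          ∑ x ∈ (T ω).filter (· ≠ ξ ω), (if h x = h (ξ ω) then (1 : ℝ) else 0) := by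
        refine Finset.sum_le_sum fun h _ => mul_le_mul_of_nonneg_left ?_ (by positivity)
        refine Finset.sum_le_sum fun ω _ => ?_
        have hnn : ∀ x ∈ (T ω).filter (· ≠ ξ ω),
            (0 : ℝ) ≤ if h x = h (ξ ω) then (1 : ℝ) else 0 := fun x _ => by
          split_ifs <;> norm_num
        split_ifs with hE
        · obtain ⟨x, hx, hne, he⟩ := hE
          refine le_mul_of_one_le_right (hp.1 ω) ?_
          have := Finset.single_le_sum hnn (Finset.mem_filter.2 ⟨hx, hne⟩)
          simpa [he] using this
        · exact mul_nonneg (hp.1 ω) (Finset.sum_nonneg hnn)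
    _ = ∑ ω, p ω * ∑ x ∈ (T ω).filter (· ≠ ξ ω),
          ∑ h : X → Fin K, 1 / N * (if h x = h (ξ ω) then (1 : ℝ) else 0) := by
        simp only [Finset.mul_sum]
        rw [Finset.sum_comm]
        refine Finset.sum_congr rfl fun ω _ => ?_
        rw [Finset.sum_comm]
        exact Finset.sum_congr rfl fun x _ => Finset.sum_congr rfl fun h _ => by ring
    _ ≤ ∑ ω, p ω * (L / K) := by
        refine Finset.sum_le_sum fun ω _ => mul_le_mul_of_nonneg_left ?_ (hp.1 ω)
        calc ∑ x ∈ (T ω).filter (· ≠ ξ ω),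
              ∑ h : X → Fin K, 1 / N * (if h x = h (ξ ω) then (1 : ℝ) else 0)
            ≤ ∑ x ∈ (T ω).filter (· ≠ ξ ω), (1 / K : ℝ) :=
              Finset.sum_le_sum fun x hx => hcol x _ (Finset.mem_filter.1 hx).2
          _ ≤ L / K := by
              rw [Finset.sum_const, nsmul_eq_mul, mul_one_div]
              gcongr
              refine le_trans ?_ (hT ω)
              exact_mod_cast Finset.card_filter_le _ _
    _ = L / K := by rw [← Finset.sum_mul, hp.2, one_mul]

/-- The covering estimate: `(1 - ω/B)^M ≤ exp(-ωM/B)`, and convexity of `exp` between `-M/B` and `0`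
separates the failure probability `1 - ω` from the codebook size. -/
theorem one_sub_pow_le {ω B a : ℝ} (hω0 : 0 ≤ ω) (hω1 : ω ≤ 1) (M : ℕ)
    (ha0 : 0 ≤ a) (ha : a ≤ 1 - ω / B) : a ^ M ≤ 1 - ω + Real.exp (-(M / B)) := by
  have h1 : a ≤ Real.exp (-(ω / B)) := by
    rw [sub_eq_neg_add] at ha
    exact ha.trans (Real.add_one_le_exp _)
  have h2 : a ^ M ≤ Real.exp (ω * -(M / B) + (1 - ω) * 0) := by
    refine (pow_le_pow_left₀ ha0 h1 M).trans_eq ?_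
    rw [← Real.exp_nat_mul]
    congr 1; ring
  have h3 := convexOn_exp.2 (Set.mem_univ (-(M / B))) (Set.mem_univ 0) hω0
    (sub_nonneg.2 hω1) (by ring)
  simp only [smul_eq_mul, Real.exp_zero, mul_one] at h3
  have h4 : ω * Real.exp (-(M / B)) ≤ Real.exp (-(M / B)) :=
    mul_le_of_le_one_left (Real.exp_nonneg _) hω1
  linarith

variable {U X Y : Type*} [Fintype U] [Fintype X] [Fintype Y]

/-- Coverage: for a random codebook with `M` words, all but a small fraction of the `y` have a
codeword `u` with `A u y`. -/
theorem exists_codebook_of_density {Q : U → ℝ} (hQ : Q ∈ stdSimplex ℝ U) {r : Y → ℝ}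
    (hr : r ∈ stdSimplex ℝ Y) {W : Y → U → ℝ} (hW : ∀ y, W y ∈ stdSimplex ℝ U) {B : ℝ}
    (hB : 0 < B) (A : U → Y → Prop) (hA : ∀ u y, A u y → W y u ≤ B * Q u) (M : ℕ) :
    ∃ c : Fin M → U, prob r (fun y => ∀ m, ¬ A (c m) y) ≤
      ∑ y, r y * prob (W y) (fun u => ¬ A u y) + Real.exp (-(M / B)) := by
  classical
  obtain ⟨c, hc⟩ := exists_codebook hQ r A M
  refine ⟨c, hc.trans ?_⟩
  have : Real.exp (-(M / B)) = ∑ y, r y * Real.exp (-(M / B)) := by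
    rw [← Finset.sum_mul, hr.2, one_mul]
  rw [this, ← Finset.sum_add_distrib]
  refine Finset.sum_le_sum fun y _ => ?_
  rw [← mul_add]
  refine mul_le_mul_of_nonneg_left ?_ (hr.1 y)
  have hsQ := prob_add_prob_not Q (fun u => A u y)
  have hsW := prob_add_prob_not (W y) (fun u => A u y)
  rw [hQ.2] at hsQ
  rw [(hW y).2] at hsW
  have h0 := prob_nonneg hQ.1 (fun u => ¬ A u y)
  have h0' := prob_nonneg (hW y).1 (fun u => A u y)
  have h0'' := prob_nonneg (hW y).1 (fun u => ¬ A u y)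
  -- The density bound on `A` is a change of measure: a codeword drawn from `Q` hits with
  -- probability at least `W(A)/B`.
  have hle : prob (W y) (fun u => A u y) ≤ B * prob Q (fun u => A u y) := by
    rw [prob, prob, Finset.mul_sum]
    refine Finset.sum_le_sum fun u _ => ?_
    by_cases h : A u y
    · simpa [h] using hA u y h
    · simp [h]
  have key := one_sub_pow_le h0' (by linarith) M h0 (by
    have : prob (W y) (fun u => A u y) / B ≤ prob Q (fun u => A u y) := by
      rwa [div_le_iff₀' hB]
    rw [← hsQ, add_sub_right_comm]
    exact le_add_of_nonneg_left (sub_nonneg.2 this))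
  linarith

/-- The joint law of `(U, X, Y)` when `U` is obtained from `Y` through the channel `W`. -/
def markovLaw (P : X × Y → ℝ) (W : Y → U → ℝ) : U × X × Y → ℝ :=
  fun w => W w.2.2 w.1 * P w.2

theorem prob_markovLaw_UY (P : X × Y → ℝ) (W : Y → U → ℝ) (E : U → Y → Prop) :
    prob (markovLaw P W) (fun w => E w.1 w.2.2) =
      ∑ y, push Prod.snd P y * prob (W y) (fun u => E u y) := by
  classical
  simp only [prob, markovLaw, Fintype.sum_prod_type, push_snd_apply, Finset.sum_mul_sum]
  rw [Finset.sum_comm]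
  rw [Finset.sum_congr rfl fun x _ => Finset.sum_comm, Finset.sum_comm]
  refine Finset.sum_congr rfl fun y _ => Finset.sum_congr rfl fun x _ =>
    Finset.sum_congr rfl fun u _ => ?_
  split_ifs <;> simp [mul_comm]

/-- One-shot source coding with a helper: random covering of `Y` and random binning of `X`. -/
theorem exists_oneShot_code [Nonempty X] {P : X × Y → ℝ} (hP : P ∈ stdSimplex ℝ (X × Y))
    {W : Y → U → ℝ} (hW : ∀ y, W y ∈ stdSimplex ℝ U) {Q : U → ℝ} (hQ : Q ∈ stdSimplex ℝ U)
    {B θ L : ℝ} (hB : 0 < B) (hθ : 0 < θ) (T : U → Finset X) (hT : ∀ u, ((T u).card : ℝ) ≤ L)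
    {K M : ℕ} (hK : 0 < K) (hM : 0 < M) :
    ∃ (e₁ : X → Fin K) (e₂ : Y → Fin M) (d : Fin K × Fin M → X),
      prob P (fun w => d (e₁ w.1, e₂ w.2) ≠ w.1) ≤
        prob (markovLaw P W) (fun w => B * Q w.1 < W w.2.2 w.1) +
        θ⁻¹ * prob (markovLaw P W) (fun w => w.2.1 ∉ T w.1) + θ + Real.exp (-(M / B)) + L / K := by
  classical
  set r := push Prod.snd P with hr
  have hrm : r ∈ stdSimplex ℝ Y := push_mem_stdSimplex _ hP
  let η : U → Y → ℝ := fun u y => ∑ x, if x ∉ T u then P (x, y) else 0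
  have hη : ∀ u y, 0 ≤ η u y := fun u y =>
    Finset.sum_nonneg fun x _ => by split_ifs <;> simp [hP.1]
  -- A codeword suits `y` if its density is bounded and, given `y`, its list misses `X` with
  -- probability at most `θ`. The second clause replaces a joint typicality argument for `X`.
  let A : U → Y → Prop := fun u y => W y u ≤ B * Q u ∧ η u y ≤ θ * r y
  obtain ⟨c, hc⟩ := exists_codebook_of_density hQ hrm hW hB A (fun u y h => h.1) M
  let e₂ : Y → Fin M := fun y => if h : ∃ m, A (c m) y then h.choose else ⟨0, hM⟩
  have he₂ : ∀ y, (∃ m, A (c m) y) → A (c (e₂ y)) y := fun y h => by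
    simp only [e₂, dif_pos h]; exact h.choose_spec
  obtain ⟨e₁, he₁⟩ := exists_binning hP (fun w => w.1) (fun w => T (c (e₂ w.2))) (fun w => hT _) hK
  let d : Fin K × Fin M → X := fun v =>
    if h : ∃ x, x ∈ T (c v.2) ∧ e₁ x = v.1 then h.choose else Classical.arbitrary X
  have hd : ∀ v, (∃ x, x ∈ T (c v.2) ∧ e₁ x = v.1) → d v ∈ T (c v.2) ∧ e₁ (d v) = v.1 :=
    fun v h => by simp only [d, dif_pos h]; exact h.choose_spec
  refine ⟨e₁, e₂, d, ?_⟩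
  -- Three causes of error: no suitable codeword, `X` outside the list, or a bin collision within
  -- the list.
  have hsub : ∀ w : X × Y, d (e₁ w.1, e₂ w.2) ≠ w.1 →
      (∀ m, ¬ A (c m) w.2) ∨ ((A (c (e₂ w.2)) w.2 ∧ w.1 ∉ T (c (e₂ w.2))) ∨
        ∃ x ∈ T (c (e₂ w.2)), x ≠ w.1 ∧ e₁ x = e₁ w.1) := by
    intro w hw
    by_cases h1 : ∃ m, A (c m) w.2
    · right
      by_cases h2 : w.1 ∈ T (c (e₂ w.2))
      · right
        obtain ⟨h3, h4⟩ := hd (e₁ w.1, e₂ w.2) ⟨w.1, h2, rfl⟩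
        exact ⟨_, h3, hw, h4⟩
      · exact Or.inl ⟨he₂ _ h1, h2⟩
    · left; simpa using h1
  have hstep := ((prob_mono hP.1 hsub).trans (prob_or_le hP.1 _ _)).trans
    (add_le_add le_rfl (prob_or_le hP.1 _ _))
  have hcover : prob P (fun w => ∀ m, ¬ A (c m) w.2) ≤
      prob (markovLaw P W) (fun w => B * Q w.1 < W w.2.2 w.1) +
        θ⁻¹ * prob (markovLaw P W) (fun w => w.2.1 ∉ T w.1) + Real.exp (-(M / B)) := by
    rw [← prob_push Prod.snd P (fun y => ∀ m, ¬ A (c m) y)]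
    refine hc.trans ?_
    rw [hr, ← prob_markovLaw_UY P W (fun u y => ¬ A u y)]
    have hml : ∀ w, 0 ≤ markovLaw P W w := fun w => mul_nonneg ((hW _).1 _) (hP.1 _)
    have hor : prob (markovLaw P W) (fun w => ¬ A w.1 w.2.2) ≤
        prob (markovLaw P W) (fun w => B * Q w.1 < W w.2.2 w.1) +
          prob (markovLaw P W) (fun w => θ * r w.2.2 < η w.1 w.2.2) := by
      refine le_trans (prob_mono hml ?_) (prob_or_le hml _ _)
      intro w hw
      simp only [A, not_and_or, not_le] at hw
      exact hw
    -- Markov's inequality for the conditional miss probability, whose mean is `Pr(X ∉ T U)`.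
    have hmarkov : prob (markovLaw P W) (fun w => θ * r w.2.2 < η w.1 w.2.2) ≤
        θ⁻¹ * prob (markovLaw P W) (fun w => w.2.1 ∉ T w.1) := by
      have e : prob (markovLaw P W) (fun w => w.2.1 ∉ T w.1) = ∑ y, ∑ u, W y u * η u y := by
        simp only [prob, markovLaw, Fintype.sum_prod_type, η, Finset.mul_sum]
        rw [Finset.sum_congr rfl fun u _ => Finset.sum_comm, Finset.sum_comm]
        refine Finset.sum_congr rfl fun y _ => Finset.sum_congr rfl fun u _ =>
          Finset.sum_congr rfl fun x _ => ?_
        split_ifs <;> simp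
      rw [prob_markovLaw_UY P W (fun u y => θ * r y < η u y), e, Finset.mul_sum]
      refine Finset.sum_le_sum fun y _ => ?_
      rw [prob, Finset.mul_sum, Finset.mul_sum]
      refine Finset.sum_le_sum fun u _ => ?_
      have hWn := (hW y).1 u
      split_ifs with h
      · rw [← hr, le_inv_mul_iff₀ hθ]
        calc θ * (r y * W y u) = W y u * (θ * r y) := by ring
          _ ≤ W y u * η u y := mul_le_mul_of_nonneg_left h.le hWn
      · rw [mul_zero]
        exact mul_nonneg (inv_nonneg.2 hθ.le) (mul_nonneg hWn (hη u y))
    linarith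
  -- The codeword is a function of `y`, so the clause on `η` applies for each `y` separately.
  have htyp : prob P (fun w => A (c (e₂ w.2)) w.2 ∧ w.1 ∉ T (c (e₂ w.2))) ≤ θ := by
    rw [prob, Fintype.sum_prod_type, Finset.sum_comm]
    calc _ ≤ ∑ y, θ * r y := by
          refine Finset.sum_le_sum fun y _ => ?_
          by_cases h : A (c (e₂ y)) y
          · simpa [h, η] using h.2
          · simpa [h] using mul_nonneg hθ.le (hrm.1 y)
      _ = θ := by rw [← Finset.mul_sum, hrm.2, mul_one]
  linarith

end OneShot

/-! ### Chernoff bounds -/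

section Chernoff

variable {α : Type*} [Fintype α]

/-- The moment generating function equals `1` at `0` and has the negative mean as its derivative
there. -/
theorem exists_exp_moment_lt_one {p : α → ℝ} (hp : p ∈ stdSimplex ℝ α) {f : α → ℝ}
    (hf : ∑ a, p a * f a < 0) : ∃ t > 0, ∑ a, p a * Real.exp (t * f a) < 1 := by
  have hd : HasDerivAt (fun t : ℝ => ∑ a, p a * Real.exp (t * f a)) (∑ a, p a * f a) 0 := by
    have : ∀ a ∈ Finset.univ, HasDerivAt (fun t : ℝ => p a * Real.exp (t * f a)) (p a * f a) 0 := by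
      intro a _
      have h1 : HasDerivAt (fun t : ℝ => t * f a) (f a) 0 := hasDerivAt_mul_const _
      simpa using (h1.exp).const_mul (p a)
    exact HasDerivAt.fun_sum this
  have h0 : ∑ a, p a * Real.exp (0 * f a) = 1 := by simpa using hp.2
  have hev := (hasDerivAt_iff_tendsto_slope.1 hd).eventually (gt_mem_nhds hf)
  have hev' := hev.filter_mono (nhdsWithin_mono 0 (s := Set.Ioi 0) fun x hx => ne_of_gt hx)
  obtain ⟨t, ht, ht0⟩ := (hev'.and self_mem_nhdsWithin).exists
  refine ⟨t, ht0, ?_⟩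
  rw [slope_def_field, h0, sub_zero, div_neg_iff] at ht
  rcases ht with h | h
  · exact absurd h.2 (not_lt.2 (le_of_lt ht0))
  · linarith [h.1]

/-- Chernoff bound for sums of i.i.d. variables with negative mean. -/
theorem exists_prob_sum_nonneg_le {p : α → ℝ} (hp : p ∈ stdSimplex ℝ α) {f : α → ℝ}
    (hf : ∑ a, p a * f a < 0) : ∃ ρ : ℝ, 0 < ρ ∧ ρ < 1 ∧ ∀ n : ℕ,
      prob (fun w : Fin n → α => ∏ i, p (w i)) (fun w => 0 ≤ ∑ i, f (w i)) ≤ ρ ^ n := by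
  classical
  obtain ⟨t, ht, hlt⟩ := exists_exp_moment_lt_one hp hf
  refine ⟨∑ a, p a * Real.exp (t * f a), ?_, hlt, fun n => ?_⟩
  · refine lt_of_le_of_ne (Finset.sum_nonneg fun a _ => mul_nonneg (hp.1 a) (Real.exp_nonneg _)) ?_
    intro h
    rw [eq_comm, Finset.sum_eq_zero_iff_of_nonneg fun a _ =>
      mul_nonneg (hp.1 a) (Real.exp_nonneg _)] at h
    have : ∑ a, p a = 0 := Finset.sum_eq_zero fun a ha =>
      (mul_eq_zero.1 (h a ha)).resolve_right (Real.exp_ne_zero _)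
    rw [hp.2] at this
    exact one_ne_zero this
  · rw [← sum_prod_fin, prob]
    refine Finset.sum_le_sum fun w _ => ?_
    rw [Finset.prod_mul_distrib, ← Real.exp_sum, ← Finset.mul_sum]
    have hnn : 0 ≤ ∏ i, p (w i) := Finset.prod_nonneg fun i _ => hp.1 _
    split_ifs with h
    · exact le_mul_of_one_le_right hnn (Real.one_le_exp (mul_nonneg ht.le h))
    · exact mul_nonneg hnn (Real.exp_nonneg _)

/-- Words over `U × X × Y` as triples of words. -/
def tripleEquiv (U X Y : Type*) (n : ℕ) :
    (Fin n → U × X × Y) ≃ (Fin n → U) × (Fin n → X) × (Fin n → Y) where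
  toFun w := (fun i => (w i).1, fun i => (w i).2.1, fun i => (w i).2.2)
  invFun v := fun i => (v.1 i, v.2.1 i, v.2.2 i)
  left_inv _ := rfl
  right_inv _ := rfl

theorem prob_equiv {β : Type*} [Fintype β] (e : α ≃ β) (p : β → ℝ) (E : β → Prop) :
    prob p E = prob (fun a => p (e a)) (fun a => E (e a)) := by
  classical
  exact (e.sum_comp fun b => if E b then p b else 0).symm

theorem prob_mono_support {p : α → ℝ} (hp : ∀ a, 0 ≤ p a) {E F : α → Prop}
    (h : ∀ a, p a ≠ 0 → E a → F a) : prob p E ≤ prob p F := by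
  classical
  refine Finset.sum_le_sum fun a _ => ?_
  by_cases ha : p a = 0
  · simp [ha]
  · by_cases hE : E a
    · simp [hE, h a ha hE]
    · simp only [hE, if_false]; split_ifs <;> simp [hp]

end Chernoff

/-! ### Typical sets of a Markov law -/

section Achievability

variable {U X Y : Type*} [Fintype U] [Fintype X] [Fintype Y]

/-- A law with vanishing divergence is Markov: `U` is obtained from `Y` through a channel. -/
theorem exists_channel_of_eq_condTimes {P : X × Y → ℝ} (hP : P ∈ stdSimplex ℝ (X × Y))
    {p : U × X × Y → ℝ} (hp : p ∈ stdSimplex ℝ (U × X × Y)) (h : p = condTimes p P) :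
    ∃ W : Y → U → ℝ, (∀ y, W y ∈ stdSimplex ℝ U) ∧ p = markovLaw P W ∧
      ∀ u y, margY p y ≠ 0 → W y u = margUY p (u, y) / margY p y := by
  classical
  have hY0 : ∀ y, 0 ≤ margY p y := push_nonneg _ hp.1
  have hUY0 : ∀ z, 0 ≤ margUY p z := push_nonneg _ hp.1
  -- Where `p_Y(y) = 0` any law would do; the `U`-marginal is a law at hand.
  let W : Y → U → ℝ := fun y u =>
    if margY p y = 0 then push Prod.fst p u else margUY p (u, y) / margY p y
  -- The `XY`-marginal is pointwise at most `P` and has the same mass, so it equals `P`; thus `P`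
  -- vanishes over letters with `p_Y(y) = 0`.
  have hzero : ∀ z : X × Y, margY p z.2 = 0 → P z = 0 := by
    have hz : ∀ z : X × Y, push Prod.snd p z = margY p z.2 / margY p z.2 * P z := by
      intro z
      rw [push_snd_apply]
      conv_lhs => rw [h]
      simp only [condTimes, ← Finset.sum_mul, ← Finset.sum_div, sum_margUY]
    have hle : ∀ z ∈ Finset.univ, push Prod.snd p z ≤ P z := fun z _ => by
      rw [hz]; exact mul_le_of_le_one_left (hP.1 z) (div_self_le_one _)
    have hsum : ∑ z, push Prod.snd p z = ∑ z, P z := by rw [sum_push, hp.2, hP.2]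
    rw [Finset.sum_eq_sum_iff_of_le hle] at hsum
    intro z h0
    rw [← hsum z (Finset.mem_univ z), hz, h0, div_zero, zero_mul]
  refine ⟨W, fun y => ?_, ?_, fun u y hy => by simp [W, hy]⟩
  · by_cases hy : margY p y = 0
    · simpa [W, hy] using push_mem_stdSimplex Prod.fst hp
    · refine ⟨fun u => ?_, ?_⟩
      · simpa [W, hy] using div_nonneg (hUY0 _) (hY0 y)
      · simp only [W, hy, if_false, ← Finset.sum_div, sum_margUY, div_self hy]
  · funext w
    by_cases hy : margY p w.2.2 = 0
    · rw [markovLaw, hzero w.2 hy, mul_zero, h, condTimes, hzero w.2 hy, mul_zero]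
    · conv_lhs => rw [h]
      simp [condTimes, markovLaw, W, hy]

theorem markovLaw_iid {U X Y : Type*} (P : X × Y → ℝ) (W : Y → U → ℝ) (n : ℕ) (w : Fin n → U × X × Y) :
    markovLaw (iid P n) (fun (y : Fin n → Y) (u : Fin n → U) => ∏ i, W (y i) (u i))
      (tripleEquiv U X Y n w) = ∏ i, markovLaw P W (w i) := by
  simp only [markovLaw, iid, tripleEquiv, Equiv.coe_fn_mk, ← Finset.prod_mul_distrib]

theorem prod_kernel_mem_stdSimplex {Y : Type*} {n : ℕ} {W : Y → U → ℝ} (hW : ∀ y, W y ∈ stdSimplex ℝ U)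
    (y : Fin n → Y) : (fun u : Fin n → U => ∏ i, W (y i) (u i)) ∈ stdSimplex ℝ (Fin n → U) := by
  classical
  refine ⟨fun u => Finset.prod_nonneg fun i _ => (hW _).1 _, ?_⟩
  have h := Finset.prod_univ_sum (fun _ : Fin n => (Finset.univ : Finset U)) (fun i u => W (y i) u)
  rw [Fintype.piFinset_univ] at h
  rw [← h]
  exact Finset.prod_eq_one fun i _ => (hW _).2

/-- Large deviations of the information density of `(U, Y)`. -/
theorem exists_density_bound {p : U × X × Y → ℝ} (hp : p ∈ stdSimplex ℝ (U × X × Y))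
    {W : Y → U → ℝ} (hWp : ∀ u y, margY p y ≠ 0 → W y u = margUY p (u, y) / margY p y)
    {I : ℝ} (hI : mutualInfo (margUY p) < I) :
    ∃ ρ : ℝ, 0 < ρ ∧ ρ < 1 ∧ ∀ n : ℕ,
      prob (fun w : Fin n → U × X × Y => ∏ i, p (w i))
        (fun w => (2 : ℝ) ^ ((n : ℝ) * I) * ∏ i, push Prod.fst p (w i).1 <
          ∏ i, W (w i).2.2 (w i).1) ≤ ρ ^ n := by
  have hpos : ∀ w, p w ≠ 0 → 0 < margUY p (w.1, w.2.2) ∧ 0 < margY p w.2.2 ∧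
      0 < push Prod.fst p w.1 := fun w hw =>
    ⟨push_pos (fun w : U × X × Y => (w.1, w.2.2)) hp.1 hw,
      push_pos (fun w : U × X × Y => w.2.2) hp.1 hw, push_pos Prod.fst hp.1 hw⟩
  -- Information density minus `I`; its mean `I(U ∧ Y) - I` is negative.
  let f : U × X × Y → ℝ := fun w =>
    Real.logb 2 (W w.2.2 w.1) - Real.logb 2 (push Prod.fst p w.1) - I
  have hmean : ∑ w, p w * f w = mutualInfo (margUY p) - I := by
    have e : I = ∑ w, p w * I := by rw [← Finset.sum_mul, hp.2, one_mul]
    rw [mutualInfo_margUY, margUY, margY, entropy_push_eq, entropy_push_eq, entropy_push_eq]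
    conv_rhs => rw [e]
    rw [← Finset.sum_add_distrib, ← Finset.sum_sub_distrib, ← Finset.sum_sub_distrib]
    refine Finset.sum_congr rfl fun w _ => ?_
    by_cases hw : p w = 0
    · simp [hw]
    obtain ⟨h1, h2, h3⟩ := hpos w hw
    simp only [f]
    rw [hWp _ _ h2.ne', Real.logb_div h1.ne' h2.ne', margUY, margY]
    ring
  obtain ⟨ρ, h0, h1, hρ⟩ := exists_prob_sum_nonneg_le hp (f := f) (by rw [hmean]; linarith)
  refine ⟨ρ, h0, h1, fun n => (prob_mono_support
    (fun w => Finset.prod_nonneg fun i _ => hp.1 _) ?_).trans (hρ n)⟩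
  intro w hw hlt
  have hw' : ∀ i, p (w i) ≠ 0 := fun i => Finset.prod_ne_zero_iff.1 hw i (Finset.mem_univ i)
  have hQ : ∀ i, 0 < push Prod.fst p (w i).1 := fun i => (hpos _ (hw' i)).2.2
  have hW : ∀ i, 0 < W (w i).2.2 (w i).1 := fun i => by
    obtain ⟨h1, h2, h3⟩ := hpos _ (hw' i)
    rw [hWp _ _ h2.ne']; positivity
  have hQp : 0 < ∏ i, push Prod.fst p (w i).1 := Finset.prod_pos fun i _ => hQ i
  have := Real.logb_lt_logb (b := 2) (by norm_num) (by positivity) hlt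
  rw [Real.logb_mul (by positivity) hQp.ne', Real.logb_rpow (by norm_num) (by norm_num),
    Real.logb_prod (hf := fun i _ => (hQ i).ne'), Real.logb_prod (hf := fun i _ => (hW i).ne')] at this
  simp only [f, Finset.sum_sub_distrib, Finset.sum_const, Finset.card_univ, Fintype.card_fin,
    nsmul_eq_mul]
  linarith

/-- The conditional law of `X` given `U`. -/
def condXU (p : U × X × Y → ℝ) (u : U) (x : X) : ℝ := margUX p (u, x) / push Prod.fst p u

theorem sum_condXU_le (p : U × X × Y → ℝ) (u : U) : ∑ x, condXU p u x ≤ 1 := by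
  simp only [condXU, ← Finset.sum_div]
  have : ∑ x, margUX p (u, x) = push Prod.fst p u := by
    rw [← push_fst_apply, margUX, push_push]; rfl
  rw [this]
  exact div_self_le_one _

theorem condXU_nonneg {p : U × X × Y → ℝ} (hp : ∀ w, 0 ≤ p w) (u : U) (x : X) :
    0 ≤ condXU p u x :=
  div_nonneg (push_nonneg _ hp _) (push_nonneg _ hp _)

/-- Large deviations of the conditional self-information of `X` given `U`. -/
theorem exists_condXU_bound {p : U × X × Y → ℝ} (hp : p ∈ stdSimplex ℝ (U × X × Y))
    {H : ℝ} (hH : condEntropy (margUX p) < H) :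
    ∃ ρ : ℝ, 0 < ρ ∧ ρ < 1 ∧ ∀ n : ℕ,
      prob (fun w : Fin n → U × X × Y => ∏ i, p (w i))
        (fun w => ∏ i, condXU p (w i).1 (w i).2.1 < (2 : ℝ) ^ (-((n : ℝ) * H))) ≤ ρ ^ n := by
  have hpos : ∀ w, p w ≠ 0 → 0 < margUX p (w.1, w.2.1) ∧ 0 < push Prod.fst p w.1 := fun w hw =>
    ⟨push_pos (fun w : U × X × Y => (w.1, w.2.1)) hp.1 hw, push_pos Prod.fst hp.1 hw⟩
  let f : U × X × Y → ℝ := fun w => -Real.logb 2 (condXU p w.1 w.2.1) - H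
  have hmean : ∑ w, p w * f w = condEntropy (margUX p) - H := by
    have e : H = ∑ w, p w * H := by rw [← Finset.sum_mul, hp.2, one_mul]
    rw [condEntropy_margUX, entropy_push_eq, entropy_push_eq]
    conv_rhs => rw [e]
    rw [← Finset.sum_sub_distrib, ← Finset.sum_sub_distrib]
    refine Finset.sum_congr rfl fun w _ => ?_
    by_cases hw : p w = 0
    · simp [hw]
    obtain ⟨h1, h2⟩ := hpos w hw
    simp only [f, condXU]
    rw [Real.logb_div h1.ne' h2.ne', margUX]
    ring
  obtain ⟨ρ, h0, h1, hρ⟩ := exists_prob_sum_nonneg_le hp (f := f) (by rw [hmean]; linarith)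
  refine ⟨ρ, h0, h1, fun n => (prob_mono_support
    (fun w => Finset.prod_nonneg fun i _ => hp.1 _) ?_).trans (hρ n)⟩
  intro w hw hlt
  have hw' : ∀ i, p (w i) ≠ 0 := fun i => Finset.prod_ne_zero_iff.1 hw i (Finset.mem_univ i)
  have hV : ∀ i, 0 < condXU p (w i).1 (w i).2.1 := fun i =>
    div_pos (hpos _ (hw' i)).1 (hpos _ (hw' i)).2
  have := Real.logb_lt_logb (b := 2) (by norm_num) (Finset.prod_pos fun i _ => hV i) hlt
  rw [Real.logb_rpow (by norm_num) (by norm_num),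
    Real.logb_prod (hf := fun i _ => (hV i).ne')] at this
  simp only [f, Finset.sum_sub_distrib, Finset.sum_const, Finset.card_univ, Fintype.card_fin,
    nsmul_eq_mul, Finset.sum_neg_distrib]
  linarith

/-- The words that are likely given `u`. -/
def likelyWords (p : U × X × Y → ℝ) {n : ℕ} (H : ℝ) (u : Fin n → U) : Finset (Fin n → X) :=
  open Classical in
  Finset.univ.filter fun x => (2 : ℝ) ^ (-((n : ℝ) * H)) ≤ ∏ i, condXU p (u i) (x i)

theorem mem_likelyWords {p : U × X × Y → ℝ} {n : ℕ} {H : ℝ} {u : Fin n → U} {x : Fin n → X} :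
    x ∈ likelyWords p H u ↔ (2 : ℝ) ^ (-((n : ℝ) * H)) ≤ ∏ i, condXU p (u i) (x i) := by
  classical
  rw [likelyWords, Finset.mem_filter, and_iff_right (Finset.mem_univ x)]

/-- Each such word has conditional weight at least `2^(-nH)`, and the weights sum to at most one. -/
theorem card_likelyWords_le {p : U × X × Y → ℝ} (hp : ∀ w, 0 ≤ p w) {n : ℕ} (H : ℝ)
    (u : Fin n → U) : ((likelyWords p H u).card : ℝ) ≤ (2 : ℝ) ^ ((n : ℝ) * H) := by
  classical
  have hnn : ∀ x : Fin n → X, 0 ≤ ∏ i, condXU p (u i) (x i) := fun x =>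
    Finset.prod_nonneg fun i _ => condXU_nonneg hp _ _
  have h := Finset.prod_univ_sum (fun _ : Fin n => (Finset.univ : Finset X))
    (fun i x => condXU p (u i) x)
  rw [Fintype.piFinset_univ] at h
  have h1 : ∑ x : Fin n → X, ∏ i, condXU p (u i) (x i) ≤ 1 := by
    rw [← h]
    exact Finset.prod_le_one (fun i _ => Finset.sum_nonneg fun x _ => condXU_nonneg hp _ _)
      fun i _ => sum_condXU_le p _
  have h2 : ((likelyWords p H u).card : ℝ) * (2 : ℝ) ^ (-((n : ℝ) * H)) ≤ 1 := by
    rw [← nsmul_eq_mul, ← Finset.sum_const]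
    refine le_trans (Finset.sum_le_sum fun x hx => (Finset.mem_filter.1 hx).2) ?_
    exact (Finset.sum_le_sum_of_subset_of_nonneg (Finset.filter_subset _ _)
      fun x _ _ => hnn x).trans h1
  rwa [Real.rpow_neg (by norm_num), ← div_eq_mul_inv, div_le_one (by positivity)] at h2

end Achievability

/-! ### The exponent vanishes exactly on the achievable region -/

section Codes

variable {X Y : Type*} [Fintype X] [Fintype Y]

theorem natCeil_two_rpow_le {n : ℕ} {R a : ℝ} (hR : 0 ≤ R) (ha : 0 < a) (hn : 1 ≤ n * a) :
    ((⌈(2 : ℝ) ^ ((n : ℝ) * (R + 2 * a))⌉₊ : ℕ) : ℝ) ≤ (2 : ℝ) ^ ((n : ℝ) * (R + 3 * a)) := by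
  have h1 : (1 : ℝ) ≤ (2 : ℝ) ^ ((n : ℝ) * (R + 2 * a)) :=
    Real.one_le_rpow (by norm_num) (by positivity)
  calc ((⌈(2 : ℝ) ^ ((n : ℝ) * (R + 2 * a))⌉₊ : ℕ) : ℝ)
      ≤ (2 : ℝ) ^ ((n : ℝ) * (R + 2 * a)) + 1 := (Nat.ceil_lt_add_one (by positivity)).le
    _ ≤ (2 : ℝ) ^ (1 : ℝ) * (2 : ℝ) ^ ((n : ℝ) * (R + 2 * a)) := by
        rw [Real.rpow_one]; linarith
    _ = (2 : ℝ) ^ (1 + (n : ℝ) * (R + 2 * a)) := by rw [Real.rpow_add (by norm_num)]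
    _ ≤ (2 : ℝ) ^ ((n : ℝ) * (R + 3 * a)) := by
        refine Real.rpow_le_rpow_of_exponent_le (by norm_num) ?_
        linarith

theorem two_rpow_div_natCeil_le {n : ℕ} {R a : ℝ} :
    (2 : ℝ) ^ ((n : ℝ) * (R + a)) / ((⌈(2 : ℝ) ^ ((n : ℝ) * (R + 2 * a))⌉₊ : ℕ) : ℝ) ≤
      ((2 : ℝ) ^ (-a)) ^ n := by
  have h0 : (0 : ℝ) < (2 : ℝ) ^ ((n : ℝ) * (R + 2 * a)) := by positivity
  calc (2 : ℝ) ^ ((n : ℝ) * (R + a)) / ((⌈(2 : ℝ) ^ ((n : ℝ) * (R + 2 * a))⌉₊ : ℕ) : ℝ)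
      ≤ (2 : ℝ) ^ ((n : ℝ) * (R + a)) / (2 : ℝ) ^ ((n : ℝ) * (R + 2 * a)) := by
        gcongr
        exact Nat.le_ceil _
    _ = ((2 : ℝ) ^ (-a)) ^ n := by
        rw [← Real.rpow_sub (by norm_num), ← Real.rpow_natCast, ← Real.rpow_mul (by norm_num)]
        congr 1; ring

theorem exp_neg_le_of_inv_le {t ε : ℝ} (ht : 0 < t) (h : t⁻¹ ≤ ε) : Real.exp (-t) ≤ ε := by
  rw [Real.exp_neg]
  refine le_trans (inv_anti₀ ht ?_) h
  linarith [Real.add_one_le_exp t]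

/-- Direct part: a Markov law `U - Y - X` with `H(X | U) ≤ R₁`, `I(U ∧ Y) ≤ R₂` yields codes. -/
theorem eventually_exists_code {U : Type*} [Fintype U] {P : X × Y → ℝ}
    (hP : P ∈ stdSimplex ℝ (X × Y)) {p : U × X × Y → ℝ} (hp : p ∈ stdSimplex ℝ (U × X × Y))
    (hm : p = condTimes p P) {R₁ R₂ : ℝ} (hR₁ : condEntropy (margUX p) ≤ R₁)
    (hR₂ : mutualInfo (margUY p) ≤ R₂) {γ : ℝ} (hγ : 0 < γ) :
    ∀ᶠ n : ℕ in atTop, ∃ c : Code X Y n, (c.m₁ : ℝ) ≤ (2 : ℝ) ^ ((n : ℝ) * (R₁ + γ)) ∧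
      (c.m₂ : ℝ) ≤ (2 : ℝ) ^ ((n : ℝ) * (R₂ + γ)) ∧ c.errorProb P ≤ γ := by
  obtain ⟨z⟩ : Nonempty (X × Y) := by
    by_contra h
    rw [not_nonempty_iff] at h
    simpa using hP.2
  have hX : Nonempty X := ⟨z.1⟩
  -- Three margins: the first for the typicality thresholds, the second to make the codebook and the
  -- bins exponentially larger than needed, the third to absorb the ceilings.
  set a := γ / 3 with ha
  have ha0 : 0 < a := by positivity
  have h3a : γ = 3 * a := by rw [ha]; ring
  have hR₁0 : 0 ≤ R₁ := (condEntropy_margUX_nonneg hp).trans hR₁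
  have hR₂0 : 0 ≤ R₂ := (mutualInfo_nonneg hp).trans hR₂
  obtain ⟨W, hW, hpW, hWp⟩ := exists_channel_of_eq_condTimes hP hp hm
  obtain ⟨ρ, hρ0, hρ1, hρ⟩ := exists_density_bound hp hWp (I := R₂ + a) (by linarith)
  obtain ⟨σ, hσ0, hσ1, hσ⟩ := exists_condXU_bound hp (H := R₁ + a) (by linarith)
  -- With `θ = s^n` the terms `θ` and `θ⁻¹ σ^n` are equal.
  set s := √σ with hs
  have hs0 : 0 < s := Real.sqrt_pos.2 hσ0
  have hs1 : s < 1 := by rw [hs, Real.sqrt_lt' one_pos]; simpa using hσ1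
  have hss : s * s = σ := Real.mul_self_sqrt hσ0.le
  have htwo : (2 : ℝ) ^ (-a) < 1 := Real.rpow_lt_one_of_one_lt_of_neg (by norm_num) (by linarith)
  have hlim : Tendsto (fun n : ℕ => ρ ^ n + s ^ n + s ^ n + ((2 : ℝ) ^ (-a)) ^ n
      + ((2 : ℝ) ^ (-a)) ^ n) atTop (nhds 0) := by
    have h1 := tendsto_pow_atTop_nhds_zero_of_lt_one hρ0.le hρ1
    have h2 := tendsto_pow_atTop_nhds_zero_of_lt_one hs0.le hs1
    have h3 := tendsto_pow_atTop_nhds_zero_of_lt_one (by positivity) htwo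
    simpa using (((h1.add h2).add h2).add h3).add h3
  have hna : ∀ᶠ n : ℕ in atTop, 1 ≤ (n : ℝ) * a :=
    (tendsto_natCast_atTop_atTop.atTop_mul_const ha0).eventually_ge_atTop 1
  filter_upwards [hlim.eventually (gt_mem_nhds hγ), hna] with n hn hn1
  have hMpos : 0 < ⌈(2 : ℝ) ^ ((n : ℝ) * (R₂ + 2 * a))⌉₊ := Nat.ceil_pos.2 (by positivity)
  have hKpos : 0 < ⌈(2 : ℝ) ^ ((n : ℝ) * (R₁ + 2 * a))⌉₊ := Nat.ceil_pos.2 (by positivity)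
  have hQ := push_mem_stdSimplex Prod.fst hp
  obtain ⟨e₁, e₂, d, hd⟩ := exists_oneShot_code (iid_mem_stdSimplex hP n)
    (prod_kernel_mem_stdSimplex hW) (prod_mem_stdSimplex hQ n)
    (B := (2 : ℝ) ^ ((n : ℝ) * (R₂ + a))) (θ := s ^ n) (L := (2 : ℝ) ^ ((n : ℝ) * (R₁ + a)))
    (by positivity) (by positivity) (likelyWords p (R₁ + a)) (card_likelyWords_le hp.1 (R₁ + a))
    hKpos hMpos
  refine ⟨⟨_, _, e₁, e₂, d⟩, ?_, ?_, ?_⟩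
  · rw [h3a]; exact natCeil_two_rpow_le hR₁0 ha0 hn1
  · rw [h3a]; exact natCeil_two_rpow_le hR₂0 ha0 hn1
  refine le_trans hd (le_trans ?_ hn.le)
  refine add_le_add (add_le_add (add_le_add (add_le_add ?_ ?_) le_rfl) ?_) two_rpow_div_natCeil_le
  · rw [prob_equiv (tripleEquiv U X Y n)]
    simp only [markovLaw_iid, ← hpW]
    exact hρ n
  · have h1 : prob (markovLaw (iid P n) fun (y : Fin n → Y) (u : Fin n → U) => ∏ i, W (y i) (u i))
        (fun w => w.2.1 ∉ likelyWords p (R₁ + a) w.1) ≤ σ ^ n := by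
      rw [prob_equiv (tripleEquiv U X Y n)]
      simp only [markovLaw_iid, ← hpW]
      refine le_trans (prob_mono (fun w => Finset.prod_nonneg fun i _ => hp.1 _) ?_) (hσ n)
      intro w hw
      rwa [mem_likelyWords, not_le] at hw
    rw [inv_mul_le_iff₀ (by positivity), ← mul_pow, hss]
    exact h1
  -- Here `M/B ≥ 2^(na)`, and `exp(-t) ≤ 1/t` is enough.
  · refine exp_neg_le_of_inv_le (by positivity) ?_
    rw [inv_div]
    exact two_rpow_div_natCeil_le

/-- Diagonalization: codes with any slack in rates and error give achievability. -/
theorem mem_achievableRegion_of_eventually [Nonempty X] [Nonempty Y] {P : X × Y → ℝ} {R₁ R₂ : ℝ}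
    (h : ∀ γ > 0, ∀ᶠ n : ℕ in atTop, ∃ c : Code X Y n,
      (c.m₁ : ℝ) ≤ (2 : ℝ) ^ ((n : ℝ) * (R₁ + γ)) ∧
      (c.m₂ : ℝ) ≤ (2 : ℝ) ^ ((n : ℝ) * (R₂ + γ)) ∧ c.errorProb P ≤ γ)
    (hP : ∀ z, 0 ≤ P z) : (R₁, R₂) ∈ achievableRegion P := by
  classical
  let G : (n : ℕ) → Code X Y n → ℝ → Prop := fun n c γ =>
    (c.m₁ : ℝ) ≤ (2 : ℝ) ^ ((n : ℝ) * (R₁ + γ)) ∧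
      (c.m₂ : ℝ) ≤ (2 : ℝ) ^ ((n : ℝ) * (R₂ + γ)) ∧ c.errorProb P ≤ γ
  -- The slacks attainable at length `n`. Choosing a code within `1/(n+1)` of the infimum gives one
  -- sequence whose slack tends to zero.
  let S : ℕ → Set ℝ := fun n => {γ | 0 ≤ γ ∧ ∃ c, G n c γ}
  have hbdd : ∀ n, BddBelow (S n) := fun n => ⟨0, fun γ hγ => hγ.1⟩
  have hchoose : ∀ n, ∃ v : Code X Y n × ℝ, (S n).Nonempty →
      0 ≤ v.2 ∧ v.2 < sInf (S n) + 1 / ((n : ℝ) + 1) ∧ G n v.1 v.2 := by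
    intro n
    by_cases hS : (S n).Nonempty
    · obtain ⟨γ, ⟨hγ0, c, hc⟩, hlt⟩ := exists_lt_of_csInf_lt hS
        (lt_add_of_pos_right (sInf (S n)) (show (0 : ℝ) < 1 / ((n : ℝ) + 1) by positivity))
      exact ⟨(c, γ), fun _ => ⟨hγ0, hlt, hc⟩⟩
    · exact ⟨(⟨1, 1, fun _ => 0, fun _ => 0, fun _ _ => Classical.arbitrary X⟩, 0),
        fun h => absurd h hS⟩
  choose v hv using hchoose
  have hne : ∀ᶠ n in atTop, (S n).Nonempty := by
    filter_upwards [h 1 one_pos] with n ⟨c, hc⟩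
    exact ⟨1, zero_le_one, c, hc⟩
  have hγ : Tendsto (fun n => (v n).2) atTop (nhds 0) := by
    rw [tendsto_order]
    constructor
    · intro b hb
      filter_upwards [hne] with n hn
      exact hb.trans_le (hv n hn).1
    · intro b hb
      have ht : Tendsto (fun n : ℕ => 1 / ((n : ℝ) + 1)) atTop (nhds 0) :=
        tendsto_one_div_add_atTop_nhds_zero_nat
      filter_upwards [hne, h (b / 2) (by positivity),
        ht.eventually (gt_mem_nhds (show (0 : ℝ) < b / 2 by positivity))] with n hn ⟨c, hc⟩ hlt
      have h1 : sInf (S n) ≤ b / 2 := csInf_le (hbdd n) ⟨by positivity, c, hc⟩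
      linarith [(hv n hn).2.1]
  have hrate : ∀ (R : ℝ) (m : ℕ → ℕ), (∀ᶠ n in atTop, 0 < m n) →
      (∀ᶠ n in atTop, (m n : ℝ) ≤ (2 : ℝ) ^ ((n : ℝ) * (R + (v n).2))) →
      limsup (fun n : ℕ => ((1 / (n : ℝ) * Real.logb 2 (m n : ℝ) : ℝ) : EReal)) atTop ≤ R := by
    intro R m hpos hle
    have ht : Tendsto (fun n => ((R + (v n).2 : ℝ) : EReal)) atTop (nhds (R : EReal)) := by
      have := hγ.const_add R
      rw [add_zero] at this
      exact (continuous_coe_real_ereal.tendsto R).comp this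
    rw [← ht.limsup_eq]
    refine limsup_le_limsup ?_
    filter_upwards [hpos, hle, eventually_ge_atTop 1] with n h1 h2 h3
    have hn0 : (0 : ℝ) < n := by exact_mod_cast h3
    rw [EReal.coe_le_coe_iff, div_mul_eq_mul_div, one_mul, div_le_iff₀ hn0, mul_comm,
      Real.logb_le_iff_le_rpow (by norm_num) (by exact_mod_cast h1)]
    exact h2
  refine ⟨fun n => (v n).1, hrate R₁ _ ?_ ?_, hrate R₂ _ ?_ ?_, ?_⟩
  · exact Eventually.of_forall fun n => ((v n).1.enc₁ fun _ => Classical.arbitrary X).pos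
  · filter_upwards [hne] with n hn using (hv n hn).2.2.1
  · exact Eventually.of_forall fun n => ((v n).1.enc₂ fun _ => Classical.arbitrary Y).pos
  · filter_upwards [hne] with n hn using (hv n hn).2.2.2.1
  · refine squeeze_zero' (Eventually.of_forall fun n => prob_nonneg (iid_nonneg hP n) _) ?_ hγ
    filter_upwards [hne] with n hn using (hv n hn).2.2.2.2

/-- Both summands of the cost are nonnegative, so in a law of cost zero the divergence vanishes and
`I(U ∧ Y) ≤ R₂`: the hypotheses of the direct part. -/
theorem mem_achievableRegion_of_exponentF_nonpos {P : X × Y → ℝ} (hP : P ∈ stdSimplex ℝ (X × Y))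
    {R₁ R₂ : ℝ} (hF : exponentF P R₁ R₂ ≤ 0) : (R₁, R₂) ∈ achievableRegion P := by
  obtain ⟨z⟩ : Nonempty (X × Y) := by
    by_contra h
    rw [not_nonempty_iff] at h
    simpa using hP.2
  have : Nonempty X := ⟨z.1⟩
  have : Nonempty Y := ⟨z.2⟩
  obtain ⟨p, hp, hs, hR, hc⟩ := exponentF_nonpos_iff.1 hF
  rw [add_zero] at hR hc
  have hD := divReal_nonneg hP hp hs
  have hmax := le_max_right (mutualInfo (margUY p) - R₂) 0
  have hI := le_max_left (mutualInfo (margUY p) - R₂) 0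
  exact mem_achievableRegion_of_eventually
    (fun γ hγ => eventually_exists_code hP hp
      (eq_condTimes_of_divReal_nonpos hP hp hs (by linarith)) hR (by linarith) hγ) hP.1

/-- A code that decodes correctly with probability at least `1 / 2` yields a nearly optimal law. -/
theorem nearOptimal_nonempty_of_code {P : X × Y → ℝ} (hP : P ∈ stdSimplex ℝ (X × Y)) {n : ℕ}
    (hn : 1 ≤ n) (c : Code X Y n) {R₁ R₂ γ : ℝ}
    (h₁ : (c.m₁ : ℝ) ≤ (2 : ℝ) ^ ((n : ℝ) * (R₁ + γ)))
    (h₂ : (c.m₂ : ℝ) ≤ (2 : ℝ) ^ ((n : ℝ) * (R₂ + γ))) (he : c.errorProb P ≤ 1 / 2)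
    (hγ : 1 ≤ (n : ℝ) * γ) : (nearOptimal P R₁ R₂ γ).Nonempty := by
  classical
  -- For a fixed helper message the decoder outputs at most `m₁` words, which makes it a list
  -- decoder.
  let T : Fin c.m₂ → Finset (Fin n → X) := fun s => Finset.univ.image fun k => c.dec (k, s)
  have hT : ∀ s, ((T s).card : ℝ) ≤ (2 : ℝ) ^ ((n : ℝ) * (R₁ + γ)) := by
    intro s
    refine le_trans ?_ h₁
    have := Finset.card_image_le (s := Finset.univ) (f := fun k => c.dec (k, s))
    rw [Finset.card_univ, Fintype.card_fin] at this
    exact_mod_cast this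
  have hW := iid_mem_stdSimplex hP n
  have hsum := prob_add_prob_not (iid P n) fun w => c.dec (c.enc₁ w.1, c.enc₂ w.2) ≠ w.1
  rw [hW.2] at hsum
  have hhalf : 1 / 2 ≤ prob (iid P n) fun w => w.1 ∈ T (c.enc₂ w.2) := by
    have hle : prob (iid P n) (fun w => ¬ c.dec (c.enc₁ w.1, c.enc₂ w.2) ≠ w.1) ≤
        prob (iid P n) fun w => w.1 ∈ T (c.enc₂ w.2) := by
      refine prob_mono hW.1 fun w hw => ?_
      rw [not_not] at hw
      exact Finset.mem_image.2 ⟨c.enc₁ w.1, Finset.mem_univ _, hw⟩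
    rw [Code.errorProb] at he
    linarith
  obtain ⟨p, hp, hs, hR, hb⟩ := exists_law_of_list_decoding hP hn c.enc₂ T (r₂ := R₂ + γ) hT
    (by simpa using h₂) (by linarith)
  refine ⟨p, hp, hs, hR, ?_⟩
  -- Success probability `1/2` costs one bit, that is `1/n ≤ γ` per letter.
  have hlog : -Real.logb 2 (prob (iid P n) fun w => w.1 ∈ T (c.enc₂ w.2)) ≤ 1 := by
    have h := Real.logb_le_logb_of_le (b := 2) (by norm_num) (by norm_num) hhalf
    have e : Real.logb 2 (1 / 2) = -1 := by
      rw [one_div, Real.logb_inv, Real.logb_self_eq_one (by norm_num)]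
    linarith
  exact le_of_mul_le_mul_left ((hb.trans hlog).trans hγ) (by positivity : (0 : ℝ) < n)

/-- For each slack one sufficiently long code suffices; compactness then removes the slack. -/
theorem exponentF_nonpos_of_mem_achievableRegion {P : X × Y → ℝ}
    (hP : P ∈ stdSimplex ℝ (X × Y)) {R₁ R₂ : ℝ} (h : (R₁, R₂) ∈ achievableRegion P) :
    exponentF P R₁ R₂ ≤ 0 := by
  obtain ⟨c, hc₁, hc₂, herr⟩ := h
  obtain ⟨z⟩ : Nonempty (X × Y) := by
    by_contra h
    rw [not_nonempty_iff] at h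
    simpa using hP.2
  refine exponentF_nonpos_iff.2 (nearOptimal_zero_nonempty fun γ hγ => ?_)
  have hrate : ∀ (R : ℝ) (m : ℕ → ℕ), (∀ n, 0 < m n) →
      limsup (fun n : ℕ => ((1 / (n : ℝ) * Real.logb 2 (m n : ℝ) : ℝ) : EReal)) atTop ≤ R →
      ∀ᶠ n in atTop, (m n : ℝ) ≤ (2 : ℝ) ^ ((n : ℝ) * (R + γ)) := by
    intro R m hpos hlim
    have hlt : ((R : ℝ) : EReal) < ((R + γ : ℝ) : EReal) := by
      rw [EReal.coe_lt_coe_iff]; linarith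
    filter_upwards [eventually_lt_of_limsup_lt (hlim.trans_lt hlt), eventually_ge_atTop 1]
      with n h1 h2
    have hn0 : (0 : ℝ) < n := by exact_mod_cast h2
    rw [EReal.coe_lt_coe_iff, div_mul_eq_mul_div, one_mul, div_lt_iff₀ hn0, mul_comm] at h1
    exact (Real.logb_le_iff_le_rpow (by norm_num) (by exact_mod_cast hpos n)).1 h1.le
  have hna : ∀ᶠ n : ℕ in atTop, 1 ≤ (n : ℝ) * γ :=
    (tendsto_natCast_atTop_atTop.atTop_mul_const hγ).eventually_ge_atTop 1
  obtain ⟨n, h1, h2, h3, h4, h5⟩ :=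
    ((hrate R₁ _ (fun n => ((c n).enc₁ fun _ => z.1).pos) hc₁).and
      ((hrate R₂ _ (fun n => ((c n).enc₂ fun _ => z.2).pos) hc₂).and
        ((herr.eventually (gt_mem_nhds (show (0 : ℝ) < 1 / 2 by norm_num))).and
          (hna.and (eventually_ge_atTop 1))))).exists
  exact nearOptimal_nonempty_of_code hP h5 (c n) h1 h2 h3.le h4

/-- The exponent is positive exactly outside of the achievable region. -/
theorem exponentF_pos_iff {P : X × Y → ℝ} (hP : P ∈ stdSimplex ℝ (X × Y)) (R₁ R₂ : ℝ) :
    0 < exponentF P R₁ R₂ ↔ (R₁, R₂) ∉ achievableRegion P := by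
  rw [← not_le, not_iff_not]
  exact ⟨mem_achievableRegion_of_exponentF_nonpos hP, exponentF_nonpos_of_mem_achievableRegion hP⟩

end Codes

/-! ### Exponential decay -/

section Decay

theorem exists_twoPowNeg_mul_le {F : EReal} (hF : 0 < F) :
    ∃ c > (0 : ℝ), ∀ n : ℕ, 1 ≤ n → twoPowNeg ((n : EReal) * F) ≤ (2 : ℝ) ^ (-(c * (n : ℝ))) := by
  induction F with
  | bot => exact absurd hF (by simp)
  | top =>
    refine ⟨1, one_pos, fun n hn => ?_⟩
    have : (0 : EReal) < (n : EReal) := by exact_mod_cast hn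
    rw [EReal.mul_top_of_pos this, twoPowNeg, if_pos rfl]
    positivity
  | coe r =>
    refine ⟨r, by exact_mod_cast hF, fun n hn => ?_⟩
    have hmul : (n : EReal) * (r : EReal) = ((n * r : ℝ) : EReal) := by
      rw [EReal.coe_mul]; rfl
    rw [hmul, twoPowNeg, if_neg (EReal.coe_ne_top _), EReal.toReal_coe, mul_comm]

/-- The security bound decays exponentially if the exponent is positive. -/
theorem exists_exponential_bound {F : EReal} (hF : 0 < F) {δ : ℝ} (hδ : 0 < δ) :
    ∃ c > (0 : ℝ), ∃ C > (0 : ℝ), ∀ n : ℕ, 1 ≤ n →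
      twoPowNeg ((n : EReal) * F) + 1 / 2 * √((2 : ℝ) ^ (-((n : ℝ) * δ))) ≤
        C * (2 : ℝ) ^ (-(c * (n : ℝ))) := by
  obtain ⟨b, hb, hbound⟩ := exists_twoPowNeg_mul_le hF
  -- The square root halves `δ`, and the coefficients `1` and `1/2` sum to less than `2`.
  refine ⟨min b (δ / 2), lt_min hb (by positivity), 2, two_pos, fun n hn => ?_⟩
  have hn0 : (0 : ℝ) ≤ n := Nat.cast_nonneg n
  have h1 : (2 : ℝ) ^ (-(b * (n : ℝ))) ≤ (2 : ℝ) ^ (-(min b (δ / 2) * (n : ℝ))) := by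
    refine Real.rpow_le_rpow_of_exponent_le (by norm_num) (neg_le_neg ?_)
    exact mul_le_mul_of_nonneg_right (min_le_left _ _) hn0
  have h2 : √((2 : ℝ) ^ (-((n : ℝ) * δ))) ≤ (2 : ℝ) ^ (-(min b (δ / 2) * (n : ℝ))) := by
    rw [Real.sqrt_eq_rpow, ← Real.rpow_mul (by norm_num)]
    refine Real.rpow_le_rpow_of_exponent_le (by norm_num) ?_
    have := mul_le_mul_of_nonneg_right (min_le_right b (δ / 2)) hn0
    linarith
  have h3 := Real.sqrt_nonneg ((2 : ℝ) ^ (-((n : ℝ) * δ)))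
  linarith [hbound n hn]

end Decay

end

end WAK

theorem mainTheorem4 {X Y : Type*} [Fintype X] [DecidableEq X] [Fintype Y]
    (P : X × Y → ℝ) (hP : P ∈ stdSimplex ℝ (X × Y)) (R₁ R₂ δ : ℝ) (hδ : 0 < δ) :
    (∀ (n : ℕ), 1 ≤ n → ∀ (K S : Type*) [Fintype K] [Fintype S]
      (g : (Fin n → Y) → S) (Q : ((Fin n → X) → K) → ℝ),
      (Fintype.card K : ℝ) ≤ (2 : ℝ) ^ ((n : ℝ) * R₁) →
      (Fintype.card S : ℝ) ≤ (2 : ℝ) ^ ((n : ℝ) * R₂) →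
      Q ∈ stdSimplex ℝ ((Fin n → X) → K) → WAK.IsUniversalHash Q →
      WAK.securityDelta P g Q ≤
        WAK.twoPowNeg ((n : EReal) * WAK.exponentF P (R₁ + δ) R₂)
          + 1 / 2 * √((2 : ℝ) ^ (-((n : ℝ) * δ)))) ∧
    (0 < WAK.exponentF P (R₁ + δ) R₂ ↔ (R₁ + δ, R₂) ∉ WAK.achievableRegion P) ∧
    ((R₁ + δ, R₂) ∉ WAK.achievableRegion P →
      ∃ c > (0 : ℝ), ∃ C > (0 : ℝ), ∀ (n : ℕ), 1 ≤ n →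
        ∀ (K S : Type*) [Fintype K] [Fintype S]
          (g : (Fin n → Y) → S) (Q : ((Fin n → X) → K) → ℝ),
          (Fintype.card K : ℝ) ≤ (2 : ℝ) ^ ((n : ℝ) * R₁) →
          (Fintype.card S : ℝ) ≤ (2 : ℝ) ^ ((n : ℝ) * R₂) →
          Q ∈ stdSimplex ℝ ((Fin n → X) → K) → WAK.IsUniversalHash Q →
          WAK.securityDelta P g Q ≤ C * (2 : ℝ) ^ (-(c * (n : ℝ)))) := by
  refine ⟨fun n hn K S _ _ g Q hK hS hQ hu => WAK.securityDelta_le hP hn g hK hS hQ hu,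
    WAK.exponentF_pos_iff hP _ _, fun h => ?_⟩
  obtain ⟨c, hc, C, hC, hbound⟩ :=
    WAK.exists_exponential_bound ((WAK.exponentF_pos_iff hP _ _).2 h) hδ
  exact ⟨c, hc, C, hC, fun n hn K S _ _ g Q hK hS hQ hu =>
    (WAK.securityDelta_le hP hn g hK hS hQ hu).trans (hbound n hn)⟩
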